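/- Write $\mathbb{R}_+=(0,\infty)$. The Selberg class $\mathcal S$ is the set of functions $L(s)$ such that: (S1) $L(s)=\sum_{n\ge1}a(n)n^{-s}$, absolutely convergent for $\mathrm{Re}(s)>1$; (S2) $(s-1)^mL(s)$ is entire of finite order for some integer $m\ge0$, the smallest such $m$ being denoted $m_L$; (S3) there are $Q>0$, $r\ge1$, $\lambda_j>0$, $\mathrm{Re}(\mu_j)\ge0$ $(1\le j\le r)$ and $|\omega|=1$ such that $L^*(s):=Q^s\prod_{j=1}^r\Gamma(\lambda_js+\mu_j)\,L(s)$ satisfies $L^*(s)=\omega\,\overline{L^*(1-\bar s)}$; (S4) $a(n)\ll_\varepsilon n^\varepsilon$ for every $\varepsilon>0$; (S5) $\log L(s)=\sum_{n\ge1}b(n)n^{-s}$ with $b(n)=0$ unless $n=p^k$ for a prime $p$ and $k\ge1$, and $b(n)\ll n^\theta$ for some $\theta<\tfrac12$. The function $L$ has a rank-$1$ Euler product if for every prime $p$ there is $c(p)\in\mathbb{C}$ with $\sum_{k\ge0}a(p^k)p^{-ks}=(1-c(p)p^{-s})^{-1}$ for $\mathrm{Re}(s)>0$, and $c(p)\ne0$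 for all but finitely many $p$. Let $\phi:\mathbb{R}_+\to\mathbb{C}$ be a smooth function such that $|\phi(u)|\le Cu^2$ for some $C>0$ and all $u>0$, and such that $L_\phi(s)=\sum_{n\ge1}\phi(n)n^{-s}$ (continued analytically from a half-plane $\mathrm{Re}(s)>\sigma$) belongs to $\mathcal S$ and has a rank-$1$ Euler product; that is, $\phi\in C_L(1)$. Let $m_\phi=m_{L_\phi}$, let $L_\phi^*$ be a completed function of $L_\phi$ as in (S3), and let $\zeta^*(s)=\pi^{-s/2}\Gamma(s/2)\zeta(s)$. Then for every smooth $h:\mathbb{R}_+\to\mathbb{C}$ with compact support in $\mathbb{R}_+$, as $x\to0^+$, $$m_\phi\int_0^\infty h(xu)\,du-\sum_{L_\phi^*(\rho)=0}\int_0^\infty h(xu)u^\rho\,\frac{du}{u}=\int_0^\infty h(xu)\phi(u)\,du-\sum_{\zeta^*(\rho)=0}\int_0^\infty h(xu)\phi(u)u^\rho\,\frac{du}{u}+O(1),$$ where the sums run over all zeros of $L_\phi^*$ and of $\zeta^*$ respectively, counted with multiplicity, and converge absolutely for every $x>0$. The implied constant may depend on $\phi$ and $h$. -/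

import Mathlib

open Set Filter Topology Asymptotics MeasureTheory
open scoped ContDiff ComplexConjugate

noncomputable section

/-! ### Function spaces on the positive half-line -/

/-- Smooth complex functions with compact support in `(0, ∞)`, extended by zero to the real line. -/
def TestFunctions : Set (ℝ → ℂ) :=
  {h | ContDiff ℝ ∞ h ∧ HasCompactSupport h ∧ tsupport h ⊆ Ioi 0}

/-- The space `C_D` of smooth slowly increasing functions on `(0, ∞)`.  A function on `(0, ∞)` is
represented by a function on the real line whose values outside `(0, ∞)` are irrelevant. -/
def SlowlyIncreasing : Set (ℝ → ℂ) :=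
  {φ | ContDiffOn ℝ ∞ φ (Ioi 0) ∧
    ∃ k C : ℝ, 0 ≤ k ∧ 0 < C ∧ ∀ u : ℝ, 0 < u → ‖φ u‖ ≤ C * u ^ k}

/-! ### The Selberg class -/

/-- An entire function of finite order. -/
def IsEntireOfFiniteOrder (F : ℂ → ℂ) : Prop :=
  Differentiable ℂ F ∧
    ∃ k : ℝ, F =O[Bornology.cobounded ℂ] fun s : ℂ => Real.exp (‖s‖ ^ k)

/-- `(s - 1) ^ m * L s` is (after removing the singularity at `s = 1`) an entire function of finite
order.  The value `L 1` is irrelevant. -/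
def IsEntireAfterPole (L : ℂ → ℂ) (m : ℕ) : Prop :=
  ∃ F : ℂ → ℂ, IsEntireOfFiniteOrder F ∧ ∀ s : ℂ, s ≠ 1 → F s = (s - 1) ^ m * L s

/-- The number `m_L`: the smallest `m` such that `(s - 1) ^ m * L s` is entire of finite order. -/
def polarOrder (L : ℂ → ℂ) : ℕ := sInf {m : ℕ | IsEntireAfterPole L m}

/-- The data of a gamma factor `γ(s) = Q ^ s * ∏ j, Γ (lam j * s + mu j)`. -/
structure GammaFactor where
  Q : ℝ
  r : ℕ
  lam : Fin r → ℝ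
  mu : Fin r → ℂ
  Q_pos : 0 < Q
  one_le_r : 1 ≤ r
  lam_pos : ∀ j, 0 < lam j
  mu_re_nonneg : ∀ j, 0 ≤ (mu j).re

/-- The complete function `L*(s) = γ(s) L(s)`. -/
def GammaFactor.complete (G : GammaFactor) (L : ℂ → ℂ) (s : ℂ) : ℂ :=
  (G.Q : ℂ) ^ s * (∏ j, Complex.Gamma (G.lam j * s + G.mu j)) * L s

/-- `s` is not a pole of any of the factors `Γ (lam j * s + mu j)`. -/
def GammaFactor.RegularAt (G : GammaFactor) (s : ℂ) : Prop :=
  ∀ (j : Fin G.r) (k : ℕ), (G.lam j : ℂ) * s + G.mu j ≠ -(k : ℂ)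

/-- The functional equation `L*(s) = w conj (L*(1 - conj s))` with `|w| = 1`, as an identity of
meromorphic functions: it is required at the points where both sides are given by finite values of
the factors. -/
def GammaFactor.FunctionalEquation (G : GammaFactor) (L : ℂ → ℂ) : Prop :=
  ∃ w : ℂ, ‖w‖ = 1 ∧ ∀ s : ℂ, s ≠ 0 → s ≠ 1 → G.RegularAt s → G.RegularAt (1 - conj s) →
    G.complete L s = w * conj (G.complete L (1 - conj s))

/-- The Selberg class, with its five axioms.  The value `L 1` is irrelevant. -/
def SelbergClass : Set (ℂ → ℂ) :=
  {L | ∃ a : ℕ → ℂ,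
    -- absolutely convergent Dirichlet series
    (∀ s : ℂ, 1 < s.re → LSeriesSummable a s ∧ L s = LSeries a s) ∧
    -- continuation
    (∃ m : ℕ, IsEntireAfterPole L m) ∧
    -- functional equation
    (∃ G : GammaFactor, G.FunctionalEquation L) ∧
    -- Ramanujan bound
    (∀ ε : ℝ, 0 < ε → a =O[atTop] fun n : ℕ => (n : ℝ) ^ ε) ∧
    -- Euler product, through the logarithm of `L`
    (∃ b : ℕ → ℂ, (∀ n : ℕ, ¬ IsPrimePow n → b n = 0) ∧
      (∃ θ : ℝ, θ < 1 / 2 ∧ b =O[atTop] fun n : ℕ => (n : ℝ) ^ θ) ∧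
      ∀ s : ℂ, 1 < s.re → LSeriesSummable b s ∧ Complex.exp (LSeries b s) = L s)}

/-- The Euler factor `L_p(s) = ∑ m, a(p^m) p^(-m s)`. -/
def eulerFactor (a : ℕ → ℂ) (p : ℕ) (s : ℂ) : ℂ :=
  ∑' m : ℕ, a (p ^ m) * (p : ℂ) ^ (-((m : ℂ) * s))

/-- The Dirichlet coefficients `a` have a rank `N` Euler product: for every prime `p`,
`L_p(s) = P_p(p^(-s))⁻¹` with `P_p(X) = 1 - c₁(p) X - ⋯ - c_N(p) X^N`, and `c_N(p) ≠ 0` for all but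
finitely many `p`. -/
def HasRankEulerProduct (a : ℕ → ℂ) (N : ℕ) : Prop :=
  ∃ c : ℕ → ℕ → ℂ,
    (∀ p : ℕ, p.Prime → ∀ s : ℂ, 0 < s.re →
      eulerFactor a p s = (1 - ∑ j ∈ Finset.Icc 1 N, c j p * ((p : ℂ) ^ (-s)) ^ j)⁻¹) ∧
    {p : ℕ | p.Prime ∧ c N p = 0}.Finite

/-! ### Interpolation functions -/

/-- `L` is the function `L_φ`, that is, `L s = ∑ φ(n) n^(-s)` when `re s` is sufficiently large. -/
def IsLFunctionOf (φ : ℝ → ℂ) (L : ℂ → ℂ) : Prop :=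
  ∃ σ : ℝ, ∀ s : ℂ, σ < s.re → L s = LSeries (fun n : ℕ => φ n) s

/-- The class `C_L(N)`. -/
def InterpolationClass (N : ℕ) : Set (ℝ → ℂ) :=
  {φ | φ ∈ SlowlyIncreasing ∧
    (∃ C : ℝ, 0 < C ∧ ∀ u : ℝ, 0 < u → ‖φ u‖ ≤ C * u ^ 2) ∧
    (∃ L ∈ SelbergClass, IsLFunctionOf φ L) ∧
    HasRankEulerProduct (fun n : ℕ => φ n) N}

/-! ### Sums over zeros -/

/-- The multiplicity of `ρ` as a zero of the meromorphic function `f`; it is `0` when `ρ` is a pole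
or `f` has a finite nonzero limit at `ρ`. -/
def zeroMultiplicity (f : ℂ → ℂ) (ρ : ℂ) : ℕ := (meromorphicOrderAt f ρ).untop₀.toNat

/-- The term of `ρ` in the sum over the zeros of `f`, counted with multiplicity, of the integrals
`∫ g(u) u^ρ du / u`; it vanishes when `ρ` is not a zero of `f`. -/
def zeroTerm (f : ℂ → ℂ) (g : ℝ → ℂ) (ρ : ℂ) : ℂ :=
  (zeroMultiplicity f ρ : ℂ) * ∫ u in Ioi (0 : ℝ), g u * (u : ℂ) ^ ρ / (u : ℂ)

end

/-! ### Entire functions of finite order -/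

/-! Both sides equal the same prime sum `∑ Λ(n) φ(n) h(x n)` up to a bounded error. A rank-1 Euler
product means `φ(p ^ k) = φ(p) ^ k`, so `-L'/L` has coefficients `Λ(n) φ(n)`
(`logDeriv_eq_of_mem_interpolationClass`). Hence the explicit formula of `L_φ` tested against `h(x
u)` and that of `ζ` tested against `h(x u) φ(u)` have the same prime side.

The explicit formula (`hasSum_zeros_explicit_formula`) is proved for an entire `F` of finite order,
here `(s - 1) ^ m L(s)` or `(s - 1) ζ(s)`, and for test functions supported in `u > 1`, which is all
that `x → 0⁺` requires. No contour is moved. A high derivative of `F'/F` is an absolutely convergent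
sum of `(w - ρ) ^ (-K-1)` (`hasSum_analyticOrderNatAt_div_sub_pow`). This is integrated termwise
over a line to the right of all zeros, and each term is evaluated by Laplace inversion. The sum runs
over all zeros of `F`, trivial ones included.

It remains to discard the zeros of `F` that the gamma factor cancels; they satisfy `re ρ ≤ 0`. For
`L_φ`, shrinking `x` multiplies each term by a factor of modulus at most 1, so the absolutely
convergent sum at one fixed `x₀` bounds them all (`norm_bilateralLaplace_comp_mul_exp_le`). For `ζ`
they are the points `-2, -4, …`, where `|φ(u)| ≤ C u ^ 2` gives terms of size `exp (2 + re ρ)`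
uniformly in `x` (`norm_bilateralLaplace_mul_le`). -/

theorem exists_eq_sub_pow_mul_of_analyticOrderAt (ρ : ℂ) (n : ℕ) :
    ∀ H : ℂ → ℂ, Differentiable ℂ H → analyticOrderAt H ρ = n →
      ∃ K : ℂ → ℂ, Differentiable ℂ K ∧ K ρ ≠ 0 ∧ ∀ z, H z = (z - ρ) ^ n * K z := by
  induction n with
  | zero =>
    intro H hH h
    refine ⟨H, hH, ?_, fun z => by simp⟩
    exact (hH.analyticAt ρ).analyticOrderAt_eq_zero.1 (by simpa using h)
  | succ n ih =>
    intro H hH h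
    have h0 : H ρ = 0 := by
      apply apply_eq_zero_of_analyticOrderAt_ne_zero
      rw [h]; simp
    have hd : Differentiable ℂ (dslope H ρ) := by
      rw [← differentiableOn_univ] at hH ⊢
      exact (Complex.differentiableOn_dslope univ_mem).2 hH
    have he : H = (fun z => z - ρ) * dslope H ρ := by
      ext z
      have := sub_smul_dslope_of_zero h0 z
      simpa using this.symm
    have ho : analyticOrderAt (dslope H ρ) ρ = n := by
      have h1 : analyticOrderAt H ρ = 1 + analyticOrderAt (dslope H ρ) ρ := by
        conv_lhs => rw [he]
        rw [analyticOrderAt_mul (by fun_prop) (hd.analyticAt ρ)]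
        congr 1
        exact analyticOrderAt_id_sub_const_self
      rw [h] at h1
      have h2 : (1 : ℕ∞) + analyticOrderAt (dslope H ρ) ρ = 1 + n := by
        rw [← h1]; push_cast; ring
      exact WithTop.add_left_cancel ENat.one_ne_top h2
    obtain ⟨K, hK, hKρ, hKe⟩ := ih _ hd ho
    refine ⟨K, hK, hKρ, fun z => ?_⟩
    rw [he, Pi.mul_apply, hKe z]
    ring

theorem analyticOrderAt_ne_top_of_entire {F : ℂ → ℂ} (hF : Differentiable ℂ F) {w : ℂ}
    (hw : F w ≠ 0) (ρ : ℂ) : analyticOrderAt F ρ ≠ ⊤ := by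
  have hA : AnalyticOnNhd ℂ F univ := fun z _ => hF.analyticAt z
  refine hA.analyticOrderAt_ne_top_of_isPreconnected isPreconnected_univ (mem_univ w)
    (mem_univ ρ) ?_
  rw [(hF.analyticAt w).analyticOrderAt_eq_zero.2 hw]
  simp

theorem analyticOrderNatAt_eq_zero_of_ne {F : ℂ → ℂ} {ρ : ℂ} (h : F ρ ≠ 0) :
    analyticOrderNatAt F ρ = 0 := by
  by_contra hc
  exact h (apply_eq_zero_of_analyticOrderNatAt_ne_zero hc)

theorem analyticOrderNatAt_ne_zero_of_eq {F : ℂ → ℂ} (hF : Differentiable ℂ F) {w : ℂ}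
    (hw : F w ≠ 0) {ρ : ℂ} (h : F ρ = 0) : analyticOrderNatAt F ρ ≠ 0 := by
  intro hc
  have := Nat.cast_analyticOrderNatAt (analyticOrderAt_ne_top_of_entire hF hw ρ)
  rw [hc] at this
  exact (hF.analyticAt ρ).analyticOrderAt_eq_zero.1 this.symm h

/-- The zeros in a finite set can be divided out of an entire function. -/
theorem exists_eq_prod_mul {F : ℂ → ℂ} (hF : Differentiable ℂ F) {w : ℂ} (hw : F w ≠ 0)
    (S : Finset ℂ) :
    ∃ H : ℂ → ℂ, Differentiable ℂ H ∧ (∀ ρ ∈ S, H ρ ≠ 0) ∧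
      ∀ z, F z = (∏ ρ ∈ S, (z - ρ) ^ analyticOrderNatAt F ρ) * H z := by
  classical
  induction S using Finset.induction_on with
  | empty => exact ⟨F, hF, by simp, by simp⟩
  | insert ρ S hρ ih =>
    obtain ⟨H, hH, hH0, hHe⟩ := ih
    set P : ℂ → ℂ := fun z => ∏ ρ ∈ S, (z - ρ) ^ analyticOrderNatAt F ρ with hP
    have hPd : Differentiable ℂ P := by
      rw [hP]; fun_prop
    have hPρ : P ρ ≠ 0 := by
      rw [hP]
      refine Finset.prod_ne_zero_iff.2 fun σ hσ => pow_ne_zero _ (sub_ne_zero.2 ?_)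
      rintro rfl; exact hρ hσ
    have ho : analyticOrderAt H ρ = analyticOrderNatAt F ρ := by
      have h1 : analyticOrderAt F ρ = analyticOrderAt (P * H) ρ := by
        congr 1; ext z; exact hHe z
      rw [analyticOrderAt_mul (hPd.analyticAt ρ) (hH.analyticAt ρ),
        (hPd.analyticAt ρ).analyticOrderAt_eq_zero.2 hPρ, zero_add] at h1
      rw [← h1, Nat.cast_analyticOrderNatAt (analyticOrderAt_ne_top_of_entire hF hw ρ)]
    obtain ⟨K, hK, hKρ, hKe⟩ := exists_eq_sub_pow_mul_of_analyticOrderAt ρ _ H hH ho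
    refine ⟨K, hK, ?_, fun z => ?_⟩
    · intro σ hσ
      rcases Finset.mem_insert.1 hσ with rfl | hσ
      · exact hKρ
      · intro h0
        apply hH0 σ hσ
        rw [hKe, h0, mul_zero]
    · rw [Finset.prod_insert hρ, hHe z, hKe z]
      ring

/-- Bound for the cofactor of the zeros in a ball, and for their number. -/
theorem norm_cofactor_le {F H : ℂ → ℂ} (hH : Differentiable ℂ H) {w : ℂ} (hw : F w ≠ 0)
    {S : Finset ℂ} {m : ℂ → ℕ} (hFH : ∀ z, F z = (∏ ρ ∈ S, (z - ρ) ^ m ρ) * H z)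
    {R A : ℝ} (hR : 0 < R) (hS : ∀ ρ ∈ S, ‖ρ - w‖ ≤ R) (hA : ∀ z, ‖z - w‖ ≤ 4 * R → ‖F z‖ ≤ A)
    {z : ℂ} (hz : ‖z - w‖ ≤ 4 * R) :
    3 ^ (∑ ρ ∈ S, m ρ) * ‖H z‖ ≤ A / ‖F w‖ * ‖H w‖ := by
  set n := ∑ ρ ∈ S, m ρ with hn
  have hFw : 0 < ‖F w‖ := norm_pos_iff.2 hw
  -- On the circle of radius `4 * R` every zero is at distance at least `3 * R`; the maximum
  -- principle carries the bound on `H` inside.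
  have h1 : (3 * R) ^ n * ‖H z‖ ≤ A := by
    have key : ∀ ζ ∈ frontier (Metric.ball w (4 * R)), ‖H ζ‖ ≤ A / (3 * R) ^ n := by
      intro ζ hζ
      rw [frontier_ball w (by positivity)] at hζ
      have hζ' : ‖ζ - w‖ = 4 * R := by simpa [dist_eq_norm] using hζ
      rw [le_div_iff₀ (by positivity)]
      have h2 := hA ζ hζ'.le
      rw [hFH, norm_mul, norm_prod] at h2
      refine le_trans ?_ h2
      rw [mul_comm]
      gcongr
      rw [hn, ← Finset.prod_pow_eq_pow_sum]
      refine Finset.prod_le_prod (fun _ _ => by positivity) fun ρ hρ => ?_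
      rw [norm_pow]
      gcongr
      have h3 := norm_sub_norm_le (ζ - w) (ρ - w)
      have h4 := hS ρ hρ
      rw [sub_sub_sub_cancel_right] at h3
      linarith
    have h5 := Complex.norm_le_of_forall_mem_frontier_norm_le Metric.isBounded_ball
      hH.diffContOnCl key (z := z) (by
        rw [closure_ball w (by positivity)]
        simpa [dist_eq_norm] using hz)
    rw [le_div_iff₀ (by positivity)] at h5
    linarith
  -- At the centre each factor is at most `R`; the ratio of `3 * R` to `R` yields the gain `3 ^ n`.
  have h2 : ‖F w‖ ≤ R ^ n * ‖H w‖ := by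
    rw [hFH, norm_mul, norm_prod]
    gcongr
    rw [hn, ← Finset.prod_pow_eq_pow_sum]
    refine Finset.prod_le_prod (fun _ _ => by positivity) fun ρ hρ => ?_
    rw [norm_pow, norm_sub_rev]
    have h4 := hS ρ hρ
    gcongr
  have hA0 : 0 ≤ A := le_trans (norm_nonneg _) (hA w (by simpa using hR.le))
  rw [div_mul_eq_mul_div, le_div_iff₀ hFw]
  have hRn : 0 < R ^ n := by positivity
  rw [mul_pow] at h1
  have : R ^ n * (3 ^ n * ‖H z‖ * ‖F w‖) ≤ R ^ n * (A * ‖H w‖) := by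
    calc R ^ n * (3 ^ n * ‖H z‖ * ‖F w‖) = (3 ^ n * R ^ n * ‖H z‖) * ‖F w‖ := by ring
      _ ≤ A * (R ^ n * ‖H w‖) := by gcongr
      _ = _ := by ring
  exact le_of_mul_le_mul_left this hRn

/-- Exponential growth bound with explicit shape. -/
def HasExpGrowth (F : ℂ → ℂ) (C : ℝ) (K : ℕ) : Prop :=
  ∀ z, ‖F z‖ ≤ Real.exp (C * (1 + ‖z‖) ^ K)

/-- The exponent is rounded up to a natural number because `K` later serves as an order of
differentiation. Compactness handles the ball on which the asymptotic bound says nothing. -/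
theorem IsEntireOfFiniteOrder.exists_hasExpGrowth {F : ℂ → ℂ} (hF : IsEntireOfFiniteOrder F) :
    ∃ C K, 0 ≤ C ∧ HasExpGrowth F C K := by
  obtain ⟨hd, k, hk⟩ := hF
  obtain ⟨c, hc⟩ := hk.bound
  obtain ⟨R₀, -, hR₀⟩ := (Metric.hasBasis_cobounded_compl_closedBall (0 : ℂ)).eventually_iff.1 hc
  set R := max R₀ 1
  have hR : ∀ z, z ∉ Metric.closedBall (0 : ℂ) R → ‖F z‖ ≤ c * ‖Real.exp (‖z‖ ^ k)‖ := fun z hz =>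
    hR₀ fun h => hz (Metric.closedBall_subset_closedBall (le_max_left _ _) h)
  obtain ⟨B, hB⟩ := (isCompact_closedBall (0 : ℂ) R).exists_bound_of_continuousOn
    hd.continuous.continuousOn
  set K := ⌈k⌉₊
  set D := Real.log (1 + |c| + |B|) with hD
  have hD0 : 0 ≤ D := Real.log_nonneg (by linarith [abs_nonneg c, abs_nonneg B])
  have hDe : Real.exp D = 1 + |c| + |B| := Real.exp_log (by positivity)
  refine ⟨D + 1, K, by positivity, fun z => ?_⟩
  have h1 : (1 : ℝ) ≤ (1 + ‖z‖) ^ K := one_le_pow₀ (by linarith [norm_nonneg z])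
  by_cases hz : z ∈ Metric.closedBall (0 : ℂ) R
  · calc ‖F z‖ ≤ B := hB z hz
      _ ≤ Real.exp D := by rw [hDe]; linarith [le_abs_self B, abs_nonneg c]
      _ ≤ _ := by
        apply Real.exp_le_exp.2
        nlinarith
  · have h2 : ‖F z‖ ≤ c * ‖Real.exp (‖z‖ ^ k)‖ := hR z hz
    have hz1 : 1 ≤ ‖z‖ := by
      rw [mem_closedBall_zero_iff, not_le] at hz
      exact (le_max_right _ _).trans hz.le
    have h3 : ‖z‖ ^ k ≤ (1 + ‖z‖) ^ K := by
      calc ‖z‖ ^ k ≤ ‖z‖ ^ (K : ℝ) := Real.rpow_le_rpow_of_exponent_le hz1 (Nat.le_ceil k)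
        _ = ‖z‖ ^ K := Real.rpow_natCast _ _
        _ ≤ _ := by gcongr; linarith
    calc ‖F z‖ ≤ |c| * Real.exp (‖z‖ ^ k) := by
          refine h2.trans ?_
          rw [Real.norm_of_nonneg (Real.exp_nonneg _)]
          gcongr
          exact le_abs_self c
      _ ≤ Real.exp D * Real.exp ((1 + ‖z‖) ^ K) := by
          rw [hDe]
          gcongr
          linarith [abs_nonneg B]
      _ = Real.exp (D + (1 + ‖z‖) ^ K) := by rw [Real.exp_add]
      _ ≤ _ := by
        apply Real.exp_le_exp.2
        nlinarith

theorem HasExpGrowth.norm_le {F : ℂ → ℂ} {C : ℝ} {K : ℕ} (hC : 0 ≤ C) (hF : HasExpGrowth F C K)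
    {w z : ℂ} {R : ℝ} (hR : 0 ≤ R) (hz : ‖z - w‖ ≤ 4 * R) :
    ‖F z‖ ≤ Real.exp (C * (4 * (1 + ‖w‖)) ^ K * (1 + R) ^ K) := by
  refine (hF z).trans (Real.exp_le_exp.2 ?_)
  rw [mul_assoc, ← mul_pow]
  gcongr
  have h1 : ‖z‖ ≤ ‖z - w‖ + ‖w‖ := by simpa using norm_add_le (z - w) w
  nlinarith [norm_nonneg w, mul_nonneg (norm_nonneg w) hR]

/-- Number of zeros of an entire function of finite order in a ball. -/
theorem exists_sum_analyticOrderNatAt_le {F : ℂ → ℂ} (hF : Differentiable ℂ F) {C : ℝ} {K : ℕ}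
    (hC : 0 ≤ C) (hg : HasExpGrowth F C K) {w : ℂ} (hw : F w ≠ 0) :
    ∃ D : ℝ, 0 < D ∧ ∀ R : ℝ, 0 < R → ∀ S : Finset ℂ, (∀ ρ ∈ S, ‖ρ - w‖ ≤ R) →
      ((∑ ρ ∈ S, analyticOrderNatAt F ρ : ℕ) : ℝ) ≤ D * (1 + R) ^ K := by
  have hFw : 0 < ‖F w‖ := norm_pos_iff.2 hw
  set E := C * (4 * (1 + ‖w‖)) ^ K with hE
  have hE0 : 0 ≤ E := by positivity
  refine ⟨E + |Real.log ‖F w‖| + 1, by positivity, fun R hR S hS => ?_⟩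
  obtain ⟨H, hH, -, hFH⟩ := exists_eq_prod_mul hF hw S
  have h1 := norm_cofactor_le hH hw hFH hR hS (fun z hz => hg.norm_le hC hR.le hz) (z := w)
    (by simpa using hR.le)
  rw [← hE] at h1
  set n := ∑ ρ ∈ S, analyticOrderNatAt F ρ
  have hHw : 0 < ‖H w‖ := by
    rw [norm_pos_iff]; intro h0; apply hw; rw [hFH, h0, mul_zero]
  -- Evaluating the cofactor bound at the centre cancels `H w` and leaves a substitute for Jensen's
  -- formula.
  have h2 : (3 : ℝ) ^ n ≤ Real.exp (E * (1 + R) ^ K) / ‖F w‖ := le_of_mul_le_mul_right h1 hHw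
  have h3 := Real.log_le_log (by positivity) h2
  rw [Real.log_pow, Real.log_div (Real.exp_ne_zero _) hFw.ne', Real.log_exp] at h3
  have h4 : (1 : ℝ) ≤ Real.log 3 := by
    rw [Real.le_log_iff_exp_le (by norm_num)]
    linarith [Real.exp_one_lt_d9]
  have h5 : (n : ℝ) ≤ n * Real.log 3 := le_mul_of_one_le_right (by positivity) h4
  have h6 : (1 : ℝ) ≤ (1 + R) ^ K := one_le_pow₀ (by linarith)
  have h7 := neg_abs_le (Real.log ‖F w‖)
  nlinarith [abs_nonneg (Real.log ‖F w‖)]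

/-- Split into dyadic shells: with `1 + ‖ρ‖` of size `2 ^ i` there are `O(2 ^ (i * K))` zeros, each
of weight `O(2 ^ (-i * (K + 1)))`, which leaves a geometric series. -/
theorem summable_analyticOrderNatAt_div {F : ℂ → ℂ} (hF : Differentiable ℂ F) {C : ℝ} {K : ℕ}
    (hC : 0 ≤ C) (hg : HasExpGrowth F C K) {w : ℂ} (hw : F w ≠ 0) :
    Summable fun ρ => (analyticOrderNatAt F ρ : ℝ) / (1 + ‖ρ‖) ^ (K + 1) := by
  obtain ⟨D, hD, hDS⟩ := exists_sum_analyticOrderNatAt_le hF hC hg hw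
  set j : ℂ → ℕ := fun ρ => Nat.clog 2 ⌈1 + ‖ρ‖⌉₊ with hj
  have hj1 : ∀ ρ, 1 + ‖ρ‖ ≤ 2 ^ j ρ := fun ρ => by
    calc 1 + ‖ρ‖ ≤ (⌈1 + ‖ρ‖⌉₊ : ℝ) := Nat.le_ceil _
      _ ≤ ((2 ^ j ρ : ℕ) : ℝ) := by exact_mod_cast Nat.le_pow_clog (by norm_num) _
      _ = _ := by push_cast; rfl
  have hj2 : ∀ ρ, (2 : ℝ) ^ j ρ ≤ 4 * (1 + ‖ρ‖) := fun ρ => by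
    have h0 := norm_nonneg ρ
    rcases Nat.eq_zero_or_pos (j ρ) with h | h
    · rw [h]; simp; linarith
    · obtain ⟨i, hi⟩ := Nat.exists_eq_succ_of_ne_zero h.ne'
      have h1 : 2 ^ i < ⌈1 + ‖ρ‖⌉₊ := by
        rw [← Nat.lt_clog_iff_pow_lt (by norm_num)]
        change i < j ρ
        omega
      have h2 : (2 : ℝ) ^ i < 1 + ‖ρ‖ := by
        have := Nat.lt_ceil.1 h1
        exact_mod_cast this
      rw [hi, pow_succ]; linarith
  set M : ℝ := 4 ^ (K + 1) * D * (2 + ‖w‖) ^ K with hM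
  refine summable_of_sum_le (c := M * 2) (fun ρ => by positivity) fun S => ?_
  classical
  rw [← Finset.sum_fiberwise_of_maps_to (g := j) (t := S.image j)
    (fun ρ hρ => Finset.mem_image_of_mem j hρ)]
  have key : ∀ i ∈ S.image j, ∑ ρ ∈ S with j ρ = i,
      (analyticOrderNatAt F ρ : ℝ) / (1 + ‖ρ‖) ^ (K + 1) ≤ M * (1 / 2) ^ i := by
    intro i _
    have h1 : ∀ ρ ∈ S.filter (fun ρ => j ρ = i),
        (analyticOrderNatAt F ρ : ℝ) / (1 + ‖ρ‖) ^ (K + 1) ≤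
          analyticOrderNatAt F ρ * (4 ^ (K + 1) / (2 ^ i) ^ (K + 1)) := by
      intro ρ hρ
      rw [div_eq_mul_inv]
      gcongr
      rw [inv_eq_one_div, div_le_div_iff₀ (by positivity) (by positivity), one_mul, ← mul_pow]
      gcongr
      rw [← (Finset.mem_filter.1 hρ).2]
      exact hj2 ρ
    refine (Finset.sum_le_sum h1).trans ?_
    rw [← Finset.sum_mul]
    have h2 := hDS (2 ^ i + ‖w‖) (by positivity) (S.filter (fun ρ => j ρ = i)) (fun ρ hρ => by
      have := hj1 ρ
      rw [(Finset.mem_filter.1 hρ).2] at this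
      refine (norm_sub_le ρ w).trans ?_
      linarith)
    push_cast at h2
    have h3 : (1 + ((2 : ℝ) ^ i + ‖w‖)) ^ K ≤ (2 + ‖w‖) ^ K * (2 ^ i) ^ K := by
      rw [← mul_pow]
      gcongr
      have : (1 : ℝ) ≤ 2 ^ i := one_le_pow₀ (by norm_num)
      nlinarith [norm_nonneg w]
    calc (∑ ρ ∈ S with j ρ = i, (analyticOrderNatAt F ρ : ℝ)) * (4 ^ (K + 1) / (2 ^ i) ^ (K + 1))
        ≤ (D * ((2 + ‖w‖) ^ K * (2 ^ i) ^ K)) * (4 ^ (K + 1) / (2 ^ i) ^ (K + 1)) := by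
          gcongr
          exact h2.trans (by gcongr)
      _ = M * (1 / 2) ^ i := by
          rw [hM, pow_succ ((2 : ℝ) ^ i), one_div, inv_pow]
          field_simp
  refine (Finset.sum_le_sum key).trans ?_
  rw [← Finset.mul_sum]
  have h5 : ∑ i ∈ S.image j, ((1 : ℝ) / 2) ^ i ≤ 2 := by
    exact (summable_geometric_two.sum_le_tsum _ fun _ _ => by positivity).trans
      tsum_geometric_two.le
  gcongr

/-- Terms of a summable family tend to zero along the cofinite filter, while each zero in a fixed
ball contributes at least a fixed positive amount. -/
theorem finite_zeros_of_hasExpGrowth {F : ℂ → ℂ} (hF : Differentiable ℂ F) {C : ℝ} {K : ℕ}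
    (hC : 0 ≤ C) (hg : HasExpGrowth F C K) {w : ℂ} (hw : F w ≠ 0) (R : ℝ) :
    {ρ | F ρ = 0 ∧ ‖ρ - w‖ ≤ R}.Finite := by
  have h1 := (summable_analyticOrderNatAt_div hF hC hg hw).tendsto_cofinite_zero.eventually
    (gt_mem_nhds (show (0 : ℝ) < 1 / (1 + |R| + ‖w‖) ^ (K + 1) by positivity))
  refine (Filter.eventually_cofinite.1 h1).subset fun ρ hρ => ?_
  have h2 : (1 : ℝ) ≤ analyticOrderNatAt F ρ := by
    exact_mod_cast Nat.one_le_iff_ne_zero.2 (analyticOrderNatAt_ne_zero_of_eq hF hw hρ.1)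
  have h3 : ‖ρ‖ ≤ |R| + ‖w‖ := by
    have := norm_add_le (ρ - w) w
    rw [sub_add_cancel] at this
    linarith [hρ.2, le_abs_self R]
  simp only [mem_ofPred_eq, not_lt]
  have := norm_nonneg ρ
  gcongr ?_ / ?_ ^ _
  linarith

/-! ### Partial fractions of the logarithmic derivative -/

theorem iteratedDeriv_inv_sub (N : ℕ) (ρ w : ℂ) :
    iteratedDeriv N (fun z => (z - ρ)⁻¹) w = (-1) ^ N * N.factorial / (w - ρ) ^ (N + 1) := by
  have := congrFun (iter_deriv_inv_linear_sub (𝕜 := ℂ) N 1 ρ) w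
  rw [iteratedDeriv_eq_iterate]
  simp only [one_mul, one_pow, mul_one] at this
  rw [this, div_eq_mul_inv, show (-1 - (N : ℤ)) = -((N + 1 : ℕ) : ℤ) by push_cast; ring,
    zpow_neg, zpow_natCast]

/-- A zero-free function on a disc of controlled size has small derivatives of its logarithm at the
centre (Borel–Carathéodory and Cauchy's estimate). -/
theorem norm_iteratedDeriv_logDeriv_le {H : ℂ → ℂ} (hH : Differentiable ℂ H) {w : ℂ} {R B : ℝ}
    (hR : 0 < R) (hB : 1 < B) (h0 : ∀ z, ‖z - w‖ < R → H z ≠ 0)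
    (hb : ∀ z, ‖z - w‖ < R → ‖H z‖ ≤ B * ‖H w‖) (N : ℕ) :
    ‖iteratedDeriv N (logDeriv H) w‖ ≤
      (N + 1).factorial * (2 * Real.log B) / (R / 2) ^ (N + 1) := by
  have hmem : ∀ z, z ∈ Metric.ball w R ↔ ‖z - w‖ < R := fun z => by
    rw [Metric.mem_ball, dist_eq_norm]
  have hw : H w ≠ 0 := h0 w (by simpa using hR)
  have hd : DifferentiableOn ℂ (logDeriv H) (Metric.ball w R) := by
    intro z hz
    have hne := h0 z ((hmem z).1 hz)
    have hdd : DifferentiableAt ℂ (deriv H) z := (hH.analyticAt z).deriv.differentiableAt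
    exact (hdd.div (hH z) hne).differentiableWithinAt
  -- `G` is a primitive of `H'/H` with `G w = 0`, hence a branch of `log (H / H w)` on the disc.
  obtain ⟨G, hGw, hG⟩ := (hd.isExactOn_ball).with_val_at w 0
  have hGd : DifferentiableOn ℂ G (Metric.ball w R) :=
    fun z hz => (hG z hz).differentiableAt.differentiableWithinAt
  have hexp : ∀ z ∈ Metric.ball w R, H z = H w * Complex.exp (G z) := by
    have hder : ∀ z ∈ Metric.ball w R,
        HasDerivAt (fun z => H z * Complex.exp (-G z)) 0 z := by
      intro z hz
      have hne := h0 z ((hmem z).1 hz)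
      refine ((hH z).hasDerivAt.mul (hG z hz).neg.cexp).congr_deriv ?_
      rw [logDeriv_apply]
      simp only [Pi.neg_apply]
      field_simp
      ring
    intro z hz
    have := (convex_ball w R).is_const_of_fderivWithin_eq_zero (𝕜 := ℂ)
      (f := fun z => H z * Complex.exp (-G z))
      (fun z hz => (hder z hz).differentiableAt.differentiableWithinAt)
      (fun z hz => by
        rw [fderivWithin_of_isOpen Metric.isOpen_ball hz]
        have := (hder z hz).hasFDerivAt.fderiv
        rw [this]; ext; simp) hz (Metric.mem_ball_self hR)
    simp only [hGw, neg_zero, Complex.exp_zero, mul_one] at this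
    rw [← this, mul_assoc, ← Complex.exp_add, neg_add_cancel, Complex.exp_zero, mul_one]
  have hlog : 0 < Real.log B := Real.log_pos hB
  have hre : ∀ z, ‖z - w‖ < R → (G z).re ≤ Real.log B := by
    intro z hz
    have h1 := hb z hz
    rw [hexp z ((hmem z).2 hz), norm_mul, Complex.norm_exp, mul_comm] at h1
    have h2 := le_of_mul_le_mul_right h1 (norm_pos_iff.2 hw)
    rwa [Real.le_log_iff_exp_le (by linarith)]
  have hbc : ∀ z ∈ Metric.sphere w (R / 2), ‖G z‖ ≤ 2 * Real.log B := by
    intro z hz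
    have hz' : ‖z - w‖ = R / 2 := by rw [← dist_eq_norm]; exact hz
    have hsh : ∀ y, y ∈ Metric.ball (0 : ℂ) R → w + y ∈ Metric.ball w R := fun y hy => by
      rw [hmem]; simpa using hy
    have hdc : DifferentiableOn ℂ (fun y => G (w + y)) (Metric.ball 0 R) := by
      intro y hy
      exact ((hG _ (hsh y hy)).comp_const_add w y).differentiableAt.differentiableWithinAt
    have := Complex.borelCaratheodory_zero (f := fun y => G (w + y)) (z := z - w) hlog hdc
      (fun y hy => hre _ ((hmem _).1 (hsh y hy))) hR (by
        rw [mem_ball_zero_iff, hz']; linarith) (by simpa using hGw)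
    simp only [add_sub_cancel, hz'] at this
    refine this.trans (le_of_eq ?_)
    field_simp
    ring
  have hev : logDeriv H =ᶠ[𝓝 w] deriv G := by
    filter_upwards [Metric.ball_mem_nhds w hR] with z hz
    exact (hG z hz).deriv.symm
  -- Passing to the derivative of order `N + 1` of `G` provides the extra power of `R` in the
  -- denominator.
  rw [hev.iteratedDeriv_eq, ← iteratedDeriv_succ']
  refine Complex.norm_iteratedDeriv_le_of_forall_mem_sphere_norm_le (N + 1) (by positivity) ?_ hbc
  apply DifferentiableOn.diffContOnCl
  rw [closure_ball w (by positivity)]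
  exact hGd.mono (Metric.closedBall_subset_ball (by linarith))

theorem logDeriv_prod_sub_mul {H : ℂ → ℂ} (hH : Differentiable ℂ H) (S : Finset ℂ) (m : ℂ → ℕ)
    {z : ℂ} (hz : ∀ ρ ∈ S, z ≠ ρ) (hHz : H z ≠ 0) :
    logDeriv (fun z => (∏ ρ ∈ S, (z - ρ) ^ m ρ) * H z) z =
      ∑ ρ ∈ S, (m ρ : ℂ) * (z - ρ)⁻¹ + logDeriv H z := by
  rw [logDeriv_mul z (Finset.prod_ne_zero_iff.2 fun ρ hρ => pow_ne_zero _ (sub_ne_zero.2 (hz ρ hρ)))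
    hHz (by fun_prop) (hH z), logDeriv_prod (f := fun ρ z => (z - ρ) ^ m ρ)
      (fun ρ hρ => pow_ne_zero _ (sub_ne_zero.2 (hz ρ hρ))) (fun ρ _ => by fun_prop)]
  congr 1
  refine Finset.sum_congr rfl fun ρ _ => ?_
  rw [logDeriv_fun_pow (by fun_prop), logDeriv_apply]
  simp [div_eq_mul_inv]

theorem exists_forall_norm_sub_pow_ge (w : ℂ) {δ : ℝ} (hδ : 0 < δ) :
    ∃ c : ℝ, 0 < c ∧ ∀ ρ : ℂ, δ ≤ ‖w - ρ‖ → c * (1 + ‖ρ‖) ≤ ‖w - ρ‖ := by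
  refine ⟨δ / (1 + ‖w‖ + δ), by positivity, fun ρ hρ => ?_⟩
  have h1 : ‖ρ‖ ≤ ‖w‖ + ‖w - ρ‖ := by
    have := norm_sub_le w (w - ρ)
    simpa using this
  rw [div_mul_eq_mul_div, div_le_iff₀ (by positivity)]
  nlinarith [norm_nonneg w]

theorem summable_analyticOrderNatAt_div_sub_pow {F : ℂ → ℂ} (hF : Differentiable ℂ F) {C : ℝ}
    {K : ℕ} (hC : 0 ≤ C) (hg : HasExpGrowth F C K) {w : ℂ} (hw : F w ≠ 0) :
    Summable fun ρ => (analyticOrderNatAt F ρ : ℂ) / (w - ρ) ^ (K + 1) := by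
  obtain ⟨δ, hδ, hδF⟩ := Metric.eventually_nhds_iff.1 (hF.continuous.continuousAt.eventually_ne hw)
  obtain ⟨c, hc, hcρ⟩ := exists_forall_norm_sub_pow_ge w hδ
  refine Summable.of_norm_bounded
    ((summable_analyticOrderNatAt_div hF hC hg hw).mul_left (1 / c ^ (K + 1))) fun ρ => ?_
  by_cases hρ : F ρ = 0
  · have h1 : δ ≤ ‖w - ρ‖ := by
      by_contra! h
      exact hδF (by rwa [dist_comm, dist_eq_norm]) hρ
    rw [norm_div, norm_pow, Complex.norm_natCast, one_div_mul_eq_div, div_div]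
    gcongr
    rw [← mul_pow, mul_comm]
    gcongr
    exact hcρ ρ h1
  · rw [analyticOrderNatAt_eq_zero_of_ne hρ]; simp

theorem iteratedDeriv_logDeriv_eq_sum_add {F H : ℂ → ℂ} (hH : Differentiable ℂ H) {S : Finset ℂ}
    {m : ℂ → ℕ} (hFH : ∀ z, F z = (∏ ρ ∈ S, (z - ρ) ^ m ρ) * H z) {w : ℂ}
    (hwS : ∀ ρ ∈ S, w ≠ ρ) (hw : H w ≠ 0) (N : ℕ) :
    iteratedDeriv N (logDeriv F) w =
      (-1) ^ N * N.factorial * ∑ ρ ∈ S, (m ρ : ℂ) / (w - ρ) ^ (N + 1) +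
        iteratedDeriv N (logDeriv H) w := by
  have hF : F = fun z => (∏ ρ ∈ S, (z - ρ) ^ m ρ) * H z := funext hFH
  have hev : logDeriv F =ᶠ[𝓝 w]
      (fun z => ∑ ρ ∈ S, (m ρ : ℂ) * (z - ρ)⁻¹) + logDeriv H := by
    have h1 : ∀ᶠ z in 𝓝 w, ∀ ρ ∈ S, z ≠ ρ :=
      (Filter.eventually_all_finset S).2 fun ρ hρ => eventually_ne_nhds (hwS ρ hρ)
    filter_upwards [h1, hH.continuous.continuousAt.eventually_ne hw] with z hz hHz
    rw [hF]
    exact logDeriv_prod_sub_mul hH S m hz hHz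
  have hcd : ∀ ρ ∈ S, ContDiffAt ℂ N (fun z => (m ρ : ℂ) * (z - ρ)⁻¹) w := fun ρ hρ =>
    contDiffAt_const.mul ((contDiffAt_id.sub contDiffAt_const).inv (sub_ne_zero.2 (hwS ρ hρ)))
  have hcH : ContDiffAt ℂ N (logDeriv H) w := by
    have : AnalyticAt ℂ (logDeriv H) w := (hH.analyticAt w).deriv.div (hH.analyticAt w) hw
    exact this.contDiffAt
  rw [hev.iteratedDeriv_eq, iteratedDeriv_add (ContDiffAt.sum hcd) hcH, Finset.mul_sum]
  congr 1
  rw [iteratedDeriv_fun_sum hcd]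
  refine Finset.sum_congr rfl fun ρ hρ => ?_
  have hinv : ContDiffAt ℂ N (fun z => (z - ρ)⁻¹) w :=
    (contDiffAt_id.sub contDiffAt_const).inv (sub_ne_zero.2 (hwS ρ hρ))
  rw [iteratedDeriv_const_mul _ hinv, iteratedDeriv_inv_sub]
  ring

/-- Partial fractions for the derivatives of the logarithmic derivative of an entire function of
finite order. -/
theorem hasSum_analyticOrderNatAt_div_sub_pow {F : ℂ → ℂ} (hF : Differentiable ℂ F) {C : ℝ}
    {K : ℕ} (hC : 0 ≤ C) (hg : HasExpGrowth F C K) {w : ℂ} (hw : F w ≠ 0) :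
    HasSum (fun ρ => (analyticOrderNatAt F ρ : ℂ) / (w - ρ) ^ (K + 1))
      ((-1) ^ K / K.factorial * iteratedDeriv K (logDeriv F) w) := by
  have hsum := summable_analyticOrderNatAt_div_sub_pow hF hC hg hw
  set f : ℂ → ℂ := fun ρ => (analyticOrderNatAt F ρ : ℂ) / (w - ρ) ^ (K + 1) with hf
  have hFw : 0 < ‖F w‖ := norm_pos_iff.2 hw
  have hfin := finite_zeros_of_hasExpGrowth hF hC hg hw
  set Z : ℕ → Finset ℂ := fun n => (hfin n).toFinset with hZ
  have hZm : ∀ n ρ, ρ ∈ Z n ↔ F ρ = 0 ∧ ‖ρ - w‖ ≤ n := fun n ρ => by simp [hZ]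
  have hlim1 : Tendsto (fun n => ∑ ρ ∈ Z n, f ρ) atTop (𝓝 (∑' ρ, f ρ)) := by
    classical
    have h1 : ∀ n, ∑ ρ ∈ Z n, f ρ = ∑' ρ, if ‖ρ - w‖ ≤ n then f ρ else 0 := by
      intro n
      rw [tsum_eq_sum (s := Z n)]
      · exact Finset.sum_congr rfl fun ρ hρ => (if_pos ((hZm n ρ).1 hρ).2).symm
      · intro ρ hρ
        split_ifs with h
        · have : F ρ ≠ 0 := fun h0 => hρ ((hZm n ρ).2 ⟨h0, h⟩)
          simp [hf, analyticOrderNatAt_eq_zero_of_ne this]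
        · rfl
    simp_rw [h1]
    refine tendsto_tsum_of_dominated_convergence hsum.norm (fun ρ => ?_)
      (Eventually.of_forall fun n ρ => ?_)
    · refine tendsto_const_nhds.congr' ?_
      filter_upwards [eventually_ge_atTop ⌈‖ρ - w‖⌉₊] with n hn
      rw [if_pos (Nat.ceil_le.1 hn)]
    · split_ifs <;> simp
  set E := C * (4 * (1 + ‖w‖)) ^ K with hE
  have hE0 : 0 ≤ E := by positivity
  set D := E + |Real.log ‖F w‖| + 1 with hD
  have hD0 : 0 < D := by positivity
  -- With the zeros in the ball of radius `n` divided out, the remainder is controlled by `log B = D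
  -- * (1 + n) ^ K` over `(n / 2) ^ (K + 1)`, hence is `O(1 / n)`.
  have hbound : ∀ n : ℕ, 1 ≤ n → ‖(-1) ^ K / K.factorial * iteratedDeriv K (logDeriv F) w -
      ∑ ρ ∈ Z n, f ρ‖ ≤ (K + 1 : ℕ).factorial * (2 * D * 2 ^ K) * 2 ^ (K + 1) / n := by
    intro n hn
    have hn' : (1 : ℝ) ≤ n := by exact_mod_cast hn
    obtain ⟨H, hH, hHZ, hFH⟩ := exists_eq_prod_mul hF hw (Z n)
    have hHw : H w ≠ 0 := by
      intro h0; apply hw; rw [hFH, h0, mul_zero]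
    rw [iteratedDeriv_logDeriv_eq_sum_add hH hFH (fun ρ hρ h => hw (by rw [h]; exact ((hZm n ρ).1 hρ).1)) hHw K]
    have hk : ((K.factorial : ℂ)) ≠ 0 := by exact_mod_cast K.factorial_ne_zero
    have hsq : ((-1 : ℂ) ^ K) * (-1) ^ K = 1 := by rw [← mul_pow]; simp
    have halg : ∀ x y : ℂ, (-1) ^ K / K.factorial * ((-1) ^ K * K.factorial * x + y) - x =
        (-1) ^ K / K.factorial * y := by
      intro x y
      field_simp
      linear_combination (K.factorial * x) * hsq
    rw [halg, norm_mul]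
    have h1 : ‖((-1) ^ K / K.factorial : ℂ)‖ ≤ 1 := by
      rw [norm_div, norm_pow, norm_neg, norm_one, one_pow, Complex.norm_natCast]
      exact div_le_one_of_le₀ (by exact_mod_cast K.factorial_pos) (by positivity)
    set B := Real.exp (D * (1 + n) ^ K) with hBd
    have h6 : (1 : ℝ) ≤ (1 + (n : ℝ)) ^ K := one_le_pow₀ (by linarith)
    have hB : 1 < B := Real.one_lt_exp_iff.2 (by positivity)
    have h2 := norm_iteratedDeriv_logDeriv_le hH (w := w) (R := n) (B := B) (by linarith) hB
      (fun z hz h0 => by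
        have hFz : F z = 0 := by rw [hFH, h0, mul_zero]
        exact hHZ z ((hZm n z).2 ⟨hFz, hz.le⟩) h0)
      (fun z hz => by
        have h3 := norm_cofactor_le hH hw hFH (R := n) (by linarith)
          (fun ρ hρ => ((hZm n ρ).1 hρ).2) (fun z hz => hg.norm_le hC (by linarith) hz) (z := z)
          (by linarith)
        have h4 : (1 : ℝ) ≤ 3 ^ (∑ ρ ∈ Z n, analyticOrderNatAt F ρ) := one_le_pow₀ (by norm_num)
        calc ‖H z‖ ≤ 3 ^ (∑ ρ ∈ Z n, analyticOrderNatAt F ρ) * ‖H z‖ :=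
              le_mul_of_one_le_left (norm_nonneg _) h4
          _ ≤ _ := h3
          _ ≤ B * ‖H w‖ := by
              gcongr
              rw [div_le_iff₀ hFw, hBd, ← hE]
              calc Real.exp (E * (1 + n) ^ K) ≤
                    Real.exp (D * (1 + n) ^ K + Real.log ‖F w‖) := by
                    apply Real.exp_le_exp.2
                    nlinarith [neg_abs_le (Real.log ‖F w‖), abs_nonneg (Real.log ‖F w‖)]
                _ = _ := by rw [Real.exp_add, Real.exp_log hFw]) K
    calc _ ≤ 1 * _ := mul_le_mul h1 h2 (norm_nonneg _) zero_le_one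
      _ = (K + 1 : ℕ).factorial * (2 * (D * (1 + n) ^ K)) / (n / 2) ^ (K + 1) := by
        rw [one_mul, hBd, Real.log_exp]
      _ ≤ (K + 1 : ℕ).factorial * (2 * (D * (2 * n) ^ K)) / (n / 2) ^ (K + 1) := by
        gcongr; linarith
      _ = _ := by
        rw [div_pow, mul_pow, pow_succ (n : ℝ)]
        field_simp
  have hlim2 : Tendsto (fun n => ∑ ρ ∈ Z n, f ρ) atTop
      (𝓝 ((-1) ^ K / K.factorial * iteratedDeriv K (logDeriv F) w)) := by
    rw [tendsto_iff_norm_sub_tendsto_zero]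
    refine squeeze_zero' (Eventually.of_forall fun _ => norm_nonneg _) ?_
      (tendsto_const_div_atTop_nhds_zero_nat
        ((K + 1 : ℕ).factorial * (2 * D * 2 ^ K) * 2 ^ (K + 1)))
    filter_upwards [eventually_ge_atTop 1] with n hn
    rw [norm_sub_rev]
    exact hbound n hn
  rw [← tendsto_nhds_unique hlim1 hlim2]
  exact hsum.hasSum

noncomputable section

/-! ### The bilateral Laplace transform of a test function -/

/-- The bilateral Laplace transform; in logarithmic coordinates, the Mellin transform. -/
def bilateralLaplace (f : ℝ → ℂ) (s : ℂ) : ℂ := ∫ y : ℝ, f y * Complex.exp (s * y)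

/-- The substitution `u = exp y`. In these coordinates the dilation by `x` becomes a translation,
and the support condition `u > 1` becomes `y > 0`. -/
theorem integral_Ioi_mul_cpow_div (g : ℝ → ℂ) (ρ : ℂ) :
    ∫ u in Ioi (0 : ℝ), g u * (u : ℂ) ^ ρ / (u : ℂ) =
      bilateralLaplace (fun y => g (Real.exp y)) ρ := by
  have h := integral_image_eq_integral_abs_deriv_smul (s := univ) MeasurableSet.univ
    (fun x _ => (Real.hasDerivAt_exp x).hasDerivWithinAt) Real.exp_injective.injOn
    (fun u : ℝ => g u * (u : ℂ) ^ ρ / (u : ℂ))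
  rw [image_univ, Real.range_exp] at h
  rw [h, setIntegral_univ, bilateralLaplace]
  refine integral_congr_ae (Eventually.of_forall fun y => ?_)
  have he : ((Real.exp y : ℝ) : ℂ) ≠ 0 := by exact_mod_cast (Real.exp_pos y).ne'
  have hc : ((Real.exp y : ℝ) : ℂ) ^ ρ = Complex.exp (ρ * y) := by
    rw [Complex.cpow_def_of_ne_zero he, ← Complex.ofReal_log (Real.exp_pos y).le, Real.log_exp,
      mul_comm]
  simp only [abs_of_pos (Real.exp_pos y), Complex.real_smul, hc]
  field_simp

theorem norm_bilateralLaplace_le (f : ℝ → ℂ) (s : ℂ) :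
    ‖bilateralLaplace f s‖ ≤ ∫ y : ℝ, ‖f y‖ * Real.exp (s.re * y) := by
  refine (norm_integral_le_integral_norm _).trans (le_of_eq ?_)
  refine integral_congr_ae (Eventually.of_forall fun y => ?_)
  simp [Complex.norm_exp]

theorem integrable_mul_of_hasCompactSupport {f g : ℝ → ℂ} (hf : Continuous f)
    (hc : HasCompactSupport f) (hg : Continuous g) : Integrable fun y => f y * g y :=
  (hf.mul hg).integrable_of_hasCompactSupport hc.mul_right

theorem mul_bilateralLaplace {f : ℝ → ℂ} (hf : ContDiff ℝ 1 f) (hc : HasCompactSupport f) (s : ℂ) :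
    s * bilateralLaplace f s = -bilateralLaplace (deriv f) s := by
  have he : Continuous fun y : ℝ => Complex.exp (s * y) := by fun_prop
  have hfd : Continuous (deriv f) := hf.continuous_deriv le_rfl
  have h1 := integrable_mul_of_hasCompactSupport hf.continuous hc he
  have h2 := integrable_mul_of_hasCompactSupport hfd hc.deriv he
  have h3 : ∀ y : ℝ, HasDerivAt (fun y : ℝ => f y * Complex.exp (s * y))
      (deriv f y * Complex.exp (s * y) + s * (f y * Complex.exp (s * y))) y := by
    intro y
    have h4 : HasDerivAt (fun y : ℝ => Complex.exp (s * y)) (Complex.exp (s * y) * s) y := by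
      have : HasDerivAt (fun y : ℝ => s * (y : ℂ)) s y := by
        simpa using (Complex.ofRealCLM.hasDerivAt (x := y)).const_mul s
      exact this.cexp
    refine (((hf.differentiable (by norm_num)) y).hasDerivAt.mul h4).congr_deriv ?_
    ring
  have h5 := integral_eq_zero_of_hasDerivAt_of_integrable h3 (h2.add (h1.const_mul s)) h1
  rw [integral_add h2 (h1.const_mul s), integral_const_mul] at h5
  rw [bilateralLaplace, bilateralLaplace]
  linear_combination h5

theorem pow_mul_bilateralLaplace (n : ℕ) : ∀ {f : ℝ → ℂ}, ContDiff ℝ ∞ f → HasCompactSupport f →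
    ∀ s : ℂ, s ^ n * bilateralLaplace f s = (-1) ^ n * bilateralLaplace (iteratedDeriv n f) s := by
  induction n with
  | zero => intro f _ _ s; simp
  | succ n ih =>
    intro f hf hc s
    have hd : ContDiff ℝ ∞ (deriv f) := (contDiff_infty_iff_deriv.1 hf).2
    have h1 := mul_bilateralLaplace (hf.of_le (by exact_mod_cast le_top)) hc s
    rw [pow_succ, mul_assoc, h1, mul_neg, ih hd hc.deriv, iteratedDeriv_succ', pow_succ]
    ring

theorem hasCompactSupport_iteratedDeriv (n : ℕ) : ∀ {f : ℝ → ℂ}, HasCompactSupport f →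
    HasCompactSupport (iteratedDeriv n f) := by
  induction n with
  | zero => intro f h; simpa using h
  | succ n ih => intro f h; rw [iteratedDeriv_succ']; exact ih h.deriv

/-- Rapid decay in vertical strips. -/
theorem exists_bilateralLaplace_decay {f : ℝ → ℂ} (hf : ContDiff ℝ ∞ f) (hc : HasCompactSupport f)
    (a : ℝ) (n : ℕ) :
    ∃ M : ℝ, 0 ≤ M ∧ ∀ s : ℂ, |s.re| ≤ a → ‖bilateralLaplace f s‖ ≤ M / (1 + ‖s‖) ^ n := by
  have hbd : ∀ k : ℕ, ∀ s : ℂ, |s.re| ≤ a → ‖bilateralLaplace (iteratedDeriv k f) s‖ ≤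
      ∫ y : ℝ, ‖iteratedDeriv k f y‖ * Real.exp (a * |y|) := by
    intro k s hs
    have hcont : Continuous (iteratedDeriv k f) := hf.continuous_iteratedDeriv k (by exact_mod_cast le_top)
    have hck := hasCompactSupport_iteratedDeriv k hc
    refine (norm_bilateralLaplace_le _ s).trans (integral_mono ?_ ?_ fun y => ?_)
    · exact (hcont.norm.mul (by fun_prop)).integrable_of_hasCompactSupport hck.norm.mul_right
    · exact (hcont.norm.mul (by fun_prop)).integrable_of_hasCompactSupport hck.norm.mul_right
    · dsimp only
      refine mul_le_mul_of_nonneg_left (Real.exp_le_exp.2 ?_) (norm_nonneg _)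
      calc s.re * y ≤ |s.re * y| := le_abs_self _
        _ = |s.re| * |y| := abs_mul _ _
        _ ≤ _ := by gcongr
  set I : ℕ → ℝ := fun k => ∫ y : ℝ, ‖iteratedDeriv k f y‖ * Real.exp (a * |y|)
  have hI : ∀ k, 0 ≤ I k := fun k => integral_nonneg fun y => by positivity
  refine ⟨2 ^ (n - 1) * (I 0 + I n), by have := hI 0; have := hI n; positivity, fun s hs => ?_⟩
  rw [le_div_iff₀ (by positivity)]
  have h1 := add_pow_le zero_le_one (norm_nonneg s) n
  have h2 := hbd 0 s hs
  have h3 := hbd n s hs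
  have h4 := congrArg norm (pow_mul_bilateralLaplace n hf hc s)
  rw [norm_mul, norm_mul, norm_pow, norm_pow, norm_neg, norm_one, one_pow, one_mul] at h4
  rw [← h4] at h3
  rw [iteratedDeriv_zero] at h2
  rw [one_pow] at h1
  calc ‖bilateralLaplace f s‖ * (1 + ‖s‖) ^ n
      ≤ ‖bilateralLaplace f s‖ * (2 ^ (n - 1) * (1 + ‖s‖ ^ n)) := by gcongr
    _ = 2 ^ (n - 1) * (‖bilateralLaplace f s‖ + ‖s‖ ^ n * ‖bilateralLaplace f s‖) := by ring
    _ ≤ _ := by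
      gcongr
      simpa [I] using h2

/-- The vertical line with abscissa `c`. -/
def verticalLine (c ξ : ℝ) : ℂ := c - 2 * Real.pi * ξ * Complex.I

@[simp] theorem verticalLine_re (c ξ : ℝ) : (verticalLine c ξ).re = c := by
  simp [verticalLine]

theorem verticalLine_im (c ξ : ℝ) : (verticalLine c ξ).im = -(2 * Real.pi * ξ) := by
  simp [verticalLine]

theorem continuous_verticalLine (c : ℝ) : Continuous (verticalLine c) := by
  unfold verticalLine; fun_prop

theorem abs_le_norm_verticalLine (c ξ : ℝ) : |ξ| ≤ ‖verticalLine c ξ‖ := by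
  refine le_trans ?_ (Complex.abs_im_le_norm _)
  rw [verticalLine_im, abs_neg, abs_mul, abs_of_pos (by positivity : 0 < 2 * Real.pi)]
  nlinarith [Real.pi_gt_three, abs_nonneg ξ]

theorem continuous_bilateralLaplace_verticalLine {f : ℝ → ℂ} (hf : Continuous f)
    (hc : HasCompactSupport f) (c : ℝ) :
    Continuous fun ξ => bilateralLaplace f (verticalLine c ξ) := by
  unfold bilateralLaplace
  have hl := continuous_verticalLine c
  refine continuous_of_dominated (bound := fun y => ‖f y‖ * Real.exp (c * y)) (fun ξ => ?_)
    (fun ξ => ?_) ?_ ?_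
  · exact (hf.mul (by fun_prop)).aestronglyMeasurable
  · exact Eventually.of_forall fun y => by simp [Complex.norm_exp]
  · exact (hf.norm.mul (by fun_prop)).integrable_of_hasCompactSupport hc.norm.mul_right
  · exact Eventually.of_forall fun y => by fun_prop

theorem integrable_pow_mul_bilateralLaplace {f : ℝ → ℂ} (hf : ContDiff ℝ ∞ f)
    (hc : HasCompactSupport f) (c : ℝ) (n : ℕ) :
    Integrable fun ξ => (1 + ‖verticalLine c ξ‖) ^ n * ‖bilateralLaplace f (verticalLine c ξ)‖ := by
  obtain ⟨M, hM, hb⟩ := exists_bilateralLaplace_decay hf hc |c| (n + 2)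
  have hint : Integrable fun ξ : ℝ => M * (1 + ‖ξ‖) ^ (-2 : ℝ) :=
    (integrable_one_add_norm (by simp)).const_mul M
  have hcl := continuous_bilateralLaplace_verticalLine hf.continuous hc c
  have hl := continuous_verticalLine c
  refine hint.mono' (by fun_prop) (Eventually.of_forall fun ξ => ?_)
  have h1 := hb (verticalLine c ξ) (by simp)
  rw [Real.norm_of_nonneg (by positivity)]
  have h2 : (1 + ‖ξ‖) ^ (-2 : ℝ) = 1 / (1 + ‖ξ‖) ^ 2 := by
    rw [Real.rpow_neg (by positivity), one_div]
    norm_cast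
  rw [h2]
  calc (1 + ‖verticalLine c ξ‖) ^ n * ‖bilateralLaplace f (verticalLine c ξ)‖
      ≤ (1 + ‖verticalLine c ξ‖) ^ n * (M / (1 + ‖verticalLine c ξ‖) ^ (n + 2)) := by gcongr
    _ = M * (1 / (1 + ‖verticalLine c ξ‖) ^ 2) := by
      rw [pow_add]; field_simp
    _ ≤ _ := by
      gcongr
      rw [Real.norm_eq_abs]
      exact abs_le_norm_verticalLine c ξ

theorem integrable_bilateralLaplace_verticalLine {f : ℝ → ℂ} (hf : ContDiff ℝ ∞ f)
    (hc : HasCompactSupport f) (c : ℝ) :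
    Integrable fun ξ => bilateralLaplace f (verticalLine c ξ) := by
  have h := integrable_pow_mul_bilateralLaplace hf hc c 0
  simp only [pow_zero, one_mul] at h
  exact (integrable_norm_iff (continuous_bilateralLaplace_verticalLine hf.continuous hc
    c).aestronglyMeasurable).1 h

/-- Inversion of the bilateral Laplace transform. -/
theorem integral_exp_mul_bilateralLaplace {f : ℝ → ℂ} (hf : ContDiff ℝ ∞ f)
    (hc : HasCompactSupport f) (c y : ℝ) :
    ∫ ξ, Complex.exp (-(verticalLine c ξ * y)) * bilateralLaplace f (verticalLine c ξ) = f y := by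
  set q : ℝ → ℂ := fun y => f y * Complex.exp (c * y) with hq
  have hqc : Continuous q := hf.continuous.mul (by fun_prop)
  have hqi : Integrable q := integrable_mul_of_hasCompactSupport hf.continuous hc (by fun_prop)
  -- The factor `-2π` in `verticalLine` makes the transform along the line literally a Fourier
  -- transform, so Fourier inversion applies.
  have hFq : FourierTransform.fourier q = fun ξ => bilateralLaplace f (verticalLine c ξ) := by
    ext ξ
    rw [Real.fourier_eq', bilateralLaplace]
    refine integral_congr_ae (Eventually.of_forall fun y => ?_)
    simp only [hq, smul_eq_mul, verticalLine]
    rw [mul_left_comm, ← Complex.exp_add]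
    congr 2
    simp
    ring
  have hinv := hqc.fourierInv_fourier_eq hqi
    (by rw [hFq]; exact integrable_bilateralLaplace_verticalLine hf hc c)
  have h1 := congrFun hinv y
  rw [hFq, Real.fourierInv_eq'] at h1
  have h2 : f y = Complex.exp (-(c * y)) * q y := by
    simp only [hq]
    rw [mul_left_comm, ← Complex.exp_add, neg_add_cancel, Complex.exp_zero, mul_one]
  rw [h2, ← h1, ← integral_const_mul]
  refine integral_congr_ae (Eventually.of_forall fun ξ => ?_)
  simp only [smul_eq_mul]
  rw [← mul_assoc, ← Complex.exp_add]
  congr 2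
  simp [verticalLine]
  ring

theorem integrableOn_pow_mul_exp {z : ℂ} (hz : 0 < z.re) (N : ℕ) :
    IntegrableOn (fun y : ℝ => (y : ℂ) ^ N * Complex.exp (-(z * y))) (Ioi 0) := by
  have h := integrableOn_rpow_mul_exp_neg_mul_rpow (p := 1) (s := N) (b := z.re)
    (by linarith [(Nat.cast_nonneg N : (0 : ℝ) ≤ N)]) one_pos hz
  refine Integrable.mono h (Continuous.aestronglyMeasurable (by fun_prop))
    (Eventually.of_forall fun y => le_of_eq ?_)
  simp [Complex.norm_exp]

theorem integral_Ioi_pow_mul_exp {z : ℂ} (hz : 0 < z.re) (N : ℕ) :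
    ∫ y in Ioi (0 : ℝ), (y : ℂ) ^ N * Complex.exp (-(z * y)) = N.factorial / z ^ (N + 1) := by
  have hz0 : z ≠ 0 := by rintro rfl; simp at hz
  have hexp : ∀ y : ℝ, HasDerivAt (fun y : ℝ => Complex.exp (-(z * y)))
      (-z * Complex.exp (-(z * y))) y := by
    intro y
    have h1 : HasDerivAt (fun y : ℝ => -(z * (y : ℂ))) (-z) y := by
      simpa using ((Complex.ofRealCLM.hasDerivAt (x := y)).const_mul z).fun_neg
    exact h1.cexp.congr_deriv (mul_comm _ _)
  induction N with
  | zero =>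
    have h1 := integrableOn_pow_mul_exp hz 0
    simp only [pow_zero, one_mul] at h1
    have h2 := integral_Ioi_of_hasDerivAt_of_tendsto' (a := (0 : ℝ)) (fun y _ => hexp y)
      (h1.const_mul (-z))
      (tendsto_zero_of_hasDerivAt_of_integrableOn_Ioi (a := (0 : ℝ)) (fun y _ => hexp y)
        (h1.const_mul (-z)) h1)
    rw [integral_const_mul] at h2
    simp only [pow_zero, one_mul, Nat.factorial_zero, zero_add, pow_one]
    rw [eq_div_iff hz0]
    simp at h2
    linear_combination h2
  | succ N ih =>
    have h0 := integrableOn_pow_mul_exp hz N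
    have h1 := integrableOn_pow_mul_exp hz (N + 1)
    have hder : ∀ y : ℝ, HasDerivAt (fun y : ℝ => (y : ℂ) ^ (N + 1) * Complex.exp (-(z * y)))
        ((N + 1) * ((y : ℂ) ^ N * Complex.exp (-(z * y))) +
          -z * ((y : ℂ) ^ (N + 1) * Complex.exp (-(z * y)))) y := by
      intro y
      have h2 : HasDerivAt (fun y : ℝ => (y : ℂ) ^ (N + 1)) ((N + 1) * (y : ℂ) ^ N) y := by
        simpa using (Complex.ofRealCLM.hasDerivAt (x := y)).fun_pow (N + 1)
      refine (h2.mul (hexp y)).congr_deriv ?_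
      ring
    have hi := (h0.const_mul ((N : ℂ) + 1)).add (h1.const_mul (-z))
    have h2 := integral_Ioi_of_hasDerivAt_of_tendsto' (a := (0 : ℝ)) (fun y _ => hder y) hi
      (tendsto_zero_of_hasDerivAt_of_integrableOn_Ioi (a := (0 : ℝ)) (fun y _ => hder y) hi h1)
    rw [integral_add (h0.const_mul _) (h1.const_mul _), integral_const_mul, integral_const_mul,
      ih] at h2
    have h3 : ((0 : ℝ) : ℂ) ^ (N + 1) = 0 := by simp
    rw [h3, zero_mul, sub_zero] at h2
    rw [eq_div_iff (pow_ne_zero _ hz0), Nat.factorial_succ]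
    field_simp at h2
    push_cast
    linear_combination (-1 : ℂ) * h2

/-- To the right of `ρ`, the kernel `(w - ρ) ^ (-N-1)` is the Laplace integral of `y ^ N * exp (ρ y)
/ N!` over `y > 0`. Fubini and inversion then recover `f`, whose support lies in that half-line. -/
theorem integral_inv_sub_pow_mul_bilateralLaplace {f : ℝ → ℂ} (hf : ContDiff ℝ ∞ f)
    (hc : HasCompactSupport f) (hs : tsupport f ⊆ Ioi 0) {c : ℝ} {ρ : ℂ} (hρ : ρ.re < c) (N : ℕ) :
    ∫ ξ, 1 / (verticalLine c ξ - ρ) ^ (N + 1) * bilateralLaplace f (verticalLine c ξ) =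
      1 / N.factorial * bilateralLaplace (fun y => (y : ℂ) ^ N * f y) ρ := by
  have hfac : (N.factorial : ℂ) ≠ 0 := by exact_mod_cast N.factorial_ne_zero
  have hl := continuous_verticalLine c
  have hcl := continuous_bilateralLaplace_verticalLine hf.continuous hc c
  have h1 : ∀ ξ, 1 / (verticalLine c ξ - ρ) ^ (N + 1) * bilateralLaplace f (verticalLine c ξ) =
      1 / N.factorial * ∫ y in Ioi (0 : ℝ), (y : ℂ) ^ N * Complex.exp (-((verticalLine c ξ - ρ) * y))
        * bilateralLaplace f (verticalLine c ξ) := by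
    intro ξ
    rw [integral_mul_const, integral_Ioi_pow_mul_exp (by simpa using hρ)]
    field_simp
  simp_rw [h1]
  rw [integral_const_mul]
  congr 1
  have hF : Integrable (Function.uncurry fun (ξ y : ℝ) => (y : ℂ) ^ N *
      Complex.exp (-((verticalLine c ξ - ρ) * y)) * bilateralLaplace f (verticalLine c ξ))
      (volume.prod (volume.restrict (Ioi (0 : ℝ)))) := by
    have hA := integrable_bilateralLaplace_verticalLine hf hc c
    have hB : Integrable (fun y : ℝ => (y : ℂ) ^ N * Complex.exp (-(((c : ℂ) - ρ) * y)))
        (volume.restrict (Ioi (0 : ℝ))) := integrableOn_pow_mul_exp (by simpa using hρ) N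
    refine (hA.mul_prod hB).mono ?_ (Eventually.of_forall fun ⟨ξ, y⟩ => ?_)
    · apply Continuous.aestronglyMeasurable
      have := hcl.comp (continuous_fst (X := ℝ) (Y := ℝ))
      have := hl.comp (continuous_fst (X := ℝ) (Y := ℝ))
      simp only [Function.uncurry_def, Function.comp_def] at *
      fun_prop
    · apply le_of_eq
      simp only [Function.uncurry_apply_pair, norm_mul, norm_pow, Complex.norm_exp]
      simp only [Complex.neg_re, Complex.re_mul_ofReal, Complex.sub_re, verticalLine_re,
        Complex.ofReal_re]
      ring
  rw [integral_integral_swap hF]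
  have h4 : ∀ y : ℝ, ∫ ξ, (y : ℂ) ^ N * Complex.exp (-((verticalLine c ξ - ρ) * y)) *
      bilateralLaplace f (verticalLine c ξ) = (y : ℂ) ^ N * f y * Complex.exp (ρ * y) := by
    intro y
    rw [← integral_exp_mul_bilateralLaplace hf hc c y, mul_assoc, mul_comm (∫ _, _), ← mul_assoc,
      ← integral_const_mul]
    refine integral_congr_ae (Eventually.of_forall fun ξ => ?_)
    dsimp only
    rw [show -((verticalLine c ξ - ρ) * (y : ℂ)) = ρ * y + -(verticalLine c ξ * y) by ring,
      Complex.exp_add]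
    ring
  simp_rw [h4]
  rw [bilateralLaplace, ← integral_indicator measurableSet_Ioi]
  refine integral_congr_ae (Eventually.of_forall fun y => ?_)
  by_cases hy : y ∈ Ioi (0 : ℝ)
  · rw [indicator_of_mem hy]
  · rw [indicator_of_notMem hy]
    have : f y = 0 := image_eq_zero_of_notMem_tsupport fun h => hy (hs h)
    simp [this]

end

/-! ### The explicit formula by termwise integration -/

theorem contDiff_div_pow {f : ℝ → ℂ} (hf : ContDiff ℝ ∞ f) (hs : tsupport f ⊆ Ioi 0) (K : ℕ) :
    ContDiff ℝ ∞ fun y => f y / (y : ℂ) ^ K := by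
  refine contDiff_iff_contDiffAt.2 fun y => ?_
  by_cases hy : y ∈ tsupport f
  · have hy0 : (y : ℂ) ≠ 0 := by exact_mod_cast (hs hy).ne'
    simp_rw [div_eq_mul_inv]
    exact hf.contDiffAt.mul (ContDiffAt.inv (Complex.ofRealCLM.contDiff.contDiffAt.pow K)
      (pow_ne_zero _ hy0))
  · have : (fun y => f y / (y : ℂ) ^ K) =ᶠ[𝓝 y] fun _ => 0 := by
      filter_upwards [notMem_tsupport_iff_eventuallyEq.1 hy] with z hz
      simp [hz]
    exact contDiffAt_const.congr_of_eventuallyEq this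

theorem tsupport_div_pow_subset (f : ℝ → ℂ) (K : ℕ) :
    tsupport (fun y => f y / (y : ℂ) ^ K) ⊆ tsupport f := by
  refine closure_mono fun y hy => ?_
  simp only [Function.mem_support] at hy ⊢
  intro h0; exact hy (by simp [h0])

/-- Termwise integration of a partial fraction series against a transform on a vertical line. -/
theorem hasSum_integral_partial_fractions {m : ℂ → ℕ} {K : ℕ}
    (hm : Summable fun ρ => (m ρ : ℝ) / (1 + ‖ρ‖) ^ (K + 1)) {a c : ℝ} (hac : a + 1 ≤ c)
    (hma : ∀ ρ, m ρ ≠ 0 → ρ.re ≤ a) {f : ℝ → ℂ} (hf : ContDiff ℝ ∞ f) (hc : HasCompactSupport f)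
    (hs : tsupport f ⊆ Ioi 0) :
    HasSum (fun ρ => (m ρ : ℂ) * (1 / K.factorial *
        bilateralLaplace (fun y => (y : ℂ) ^ K * f y) ρ))
      (∫ ξ, (∑' ρ, (m ρ : ℂ) / (verticalLine c ξ - ρ) ^ (K + 1)) *
        bilateralLaplace f (verticalLine c ξ)) := by
  set T : Set ℂ := {ρ | m ρ ≠ 0} with hT
  -- Exchanging sum and integral needs a countable index, so the sum is restricted to the points of
  -- nonzero multiplicity.
  have hTc : T.Countable := by
    refine hm.countable_support.mono fun ρ hρ => ?_
    have : (0 : ℝ) < m ρ := by exact_mod_cast Nat.pos_of_ne_zero hρ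
    rw [Function.mem_support]
    positivity
  have : Countable T := hTc
  have hl := continuous_verticalLine c
  have hcl := continuous_bilateralLaplace_verticalLine hf.continuous hc c
  set I := ∫ ξ, (1 + ‖verticalLine c ξ‖) ^ (K + 1) * ‖bilateralLaplace f (verticalLine c ξ)‖
  have hne : ∀ ρ ∈ T, ∀ ξ, 1 ≤ ‖verticalLine c ξ - ρ‖ := fun ρ hρ ξ => by
    refine le_trans ?_ ((le_abs_self _).trans (Complex.abs_re_le_norm _))
    rw [Complex.sub_re, verticalLine_re]
    linarith [hma ρ hρ]
  -- Since `‖w - ρ‖ ≥ 1`, one has `1 + ‖ρ‖ ≤ 2 * (1 + ‖w‖) * ‖w - ρ‖`. This separates `ρ` from `ξ`: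
  -- the `ρ` part is summable, and the polynomial in `w` is absorbed by the decay of the transform.
  have hbd : ∀ ρ ∈ T, ∀ ξ, ‖(m ρ : ℂ) / (verticalLine c ξ - ρ) ^ (K + 1) *
      bilateralLaplace f (verticalLine c ξ)‖ ≤ (2 ^ (K + 1) * (m ρ / (1 + ‖ρ‖) ^ (K + 1))) *
        ((1 + ‖verticalLine c ξ‖) ^ (K + 1) * ‖bilateralLaplace f (verticalLine c ξ)‖) := by
    intro ρ hρ ξ
    have h1 := hne ρ hρ ξ
    rw [norm_mul, norm_div, norm_pow, Complex.norm_natCast, ← mul_assoc]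
    gcongr
    have h2 : 1 + ‖ρ‖ ≤ 2 * (1 + ‖verticalLine c ξ‖) * ‖verticalLine c ξ - ρ‖ := by
      have h3 := norm_sub_le (verticalLine c ξ) (verticalLine c ξ - ρ)
      rw [sub_sub_cancel] at h3
      nlinarith [norm_nonneg (verticalLine c ξ)]
    rw [div_le_iff₀ (by positivity)]
    calc (m ρ : ℝ) = m ρ / (1 + ‖ρ‖) ^ (K + 1) * (1 + ‖ρ‖) ^ (K + 1) := by field_simp
      _ ≤ m ρ / (1 + ‖ρ‖) ^ (K + 1) *
          (2 * (1 + ‖verticalLine c ξ‖) * ‖verticalLine c ξ - ρ‖) ^ (K + 1) := by gcongr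
      _ = _ := by rw [mul_pow, mul_pow]; ring
  have hi := integrable_pow_mul_bilateralLaplace hf hc c (K + 1)
  have hFi : ∀ ρ : T, Integrable fun ξ => (m ρ : ℂ) / (verticalLine c ξ - ρ) ^ (K + 1) *
      bilateralLaplace f (verticalLine c ξ) := by
    intro ρ
    refine (hi.const_mul (2 ^ (K + 1) * (m ρ / (1 + ‖(ρ : ℂ)‖) ^ (K + 1)))).mono' ?_
      (Eventually.of_forall (hbd ρ ρ.2))
    refine Continuous.aestronglyMeasurable ((continuous_const.div (by fun_prop) fun ξ => ?_).mul hcl)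
    have := hne ρ ρ.2 ξ
    exact pow_ne_zero _ (norm_pos_iff.1 (by linarith))
  have key := hasSum_integral_of_summable_integral_norm hFi (by
    refine Summable.of_nonneg_of_le (fun ρ => integral_nonneg fun ξ => norm_nonneg _)
      (fun ρ => ?_) (((hm.mul_left (2 ^ (K + 1))).mul_right I).comp_injective
        (Subtype.val_injective (p := (· ∈ T))))
    rw [Function.comp_apply, ← integral_const_mul]
    exact integral_mono (hFi ρ).norm (hi.const_mul _) (hbd ρ ρ.2))
  have h1 : ∀ ξ, ∑' ρ : T, (m ρ : ℂ) / (verticalLine c ξ - ρ) ^ (K + 1) *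
      bilateralLaplace f (verticalLine c ξ) = (∑' ρ, (m ρ : ℂ) / (verticalLine c ξ - ρ) ^ (K + 1)) *
        bilateralLaplace f (verticalLine c ξ) := by
    intro ξ
    rw [tsum_mul_right]
    congr 1
    refine tsum_subtype_eq_of_support_subset (s := T)
      (f := fun ρ => (m ρ : ℂ) / (verticalLine c ξ - ρ) ^ (K + 1)) fun ρ hρ => ?_
    intro h0
    exact hρ (by simp [h0])
  have h2 : ∀ ρ : T, ∫ ξ, (m ρ : ℂ) / (verticalLine c ξ - ρ) ^ (K + 1) *
      bilateralLaplace f (verticalLine c ξ) = (m ρ : ℂ) * (1 / K.factorial *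
        bilateralLaplace (fun y => (y : ℂ) ^ K * f y) ρ) := by
    intro ρ
    rw [← integral_inv_sub_pow_mul_bilateralLaplace hf hc hs (c := c)
      (by linarith [hma ρ ρ.2]), ← integral_const_mul]
    refine integral_congr_ae (Eventually.of_forall fun ξ => ?_)
    ring
  simp_rw [h1, h2] at key
  refine (hasSum_subtype_iff_of_support_subset (s := T) (f := fun ρ => (m ρ : ℂ) *
    (1 / K.factorial * bilateralLaplace (fun y => (y : ℂ) ^ K * f y) ρ)) fun ρ hρ => ?_).1 key
  intro h0
  exact hρ (by simp [h0])

/-- The modulus of `n ^ (-s)` is constant on a vertical line, so the series is dominated termwise;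
inversion at `y = log n` evaluates each term. -/
theorem integral_LSeries_mul_bilateralLaplace {b : ℕ → ℂ} {c : ℝ} (hb : LSeriesSummable b c)
    {f : ℝ → ℂ} (hf : ContDiff ℝ ∞ f) (hc : HasCompactSupport f) (hs : tsupport f ⊆ Ioi 0) :
    Integrable (fun ξ => LSeries b (verticalLine c ξ) * bilateralLaplace f (verticalLine c ξ)) ∧
    HasSum (fun n : ℕ => b n * f (Real.log n))
      (∫ ξ, LSeries b (verticalLine c ξ) * bilateralLaplace f (verticalLine c ξ)) := by
  have hl := continuous_verticalLine c
  have hcl := continuous_bilateralLaplace_verticalLine hf.continuous hc c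
  have hi := integrable_bilateralLaplace_verticalLine hf hc c
  have hnorm : ∀ n ξ, ‖LSeries.term b (verticalLine c ξ) n‖ = ‖LSeries.term b c n‖ := by
    intro n ξ
    simp [LSeries.norm_term_eq]
  have hterm : ∀ n, Continuous fun ξ => LSeries.term b (verticalLine c ξ) n := by
    intro n
    rcases eq_or_ne n 0 with rfl | hn
    · simp [continuous_const]
    · simp_rw [LSeries.term_of_ne_zero hn]
      have hn' : (n : ℂ) ≠ 0 := by exact_mod_cast hn
      refine continuous_const.div ?_ fun ξ => ?_
      · exact hl.const_cpow (Or.inl hn')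
      · simp [Complex.cpow_eq_zero_iff, hn']
  have hFi : ∀ n, Integrable fun ξ => LSeries.term b (verticalLine c ξ) n *
      bilateralLaplace f (verticalLine c ξ) := by
    intro n
    refine (hi.norm.const_mul ‖LSeries.term b c n‖).mono' ((hterm n).mul hcl).aestronglyMeasurable
      (Eventually.of_forall fun ξ => ?_)
    rw [norm_mul, hnorm]
  have hsn : Summable fun n => ‖LSeries.term b c n‖ := hb.norm
  have h1 : ∀ n, ∫ ξ, LSeries.term b (verticalLine c ξ) n * bilateralLaplace f (verticalLine c ξ) =
      b n * f (Real.log n) := by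
    intro n
    rcases eq_or_ne n 0 with rfl | hn
    -- The index `n = 0` has `Real.log 0 = 0`, which is outside the support of `f`.
    · have : f 0 = 0 := image_eq_zero_of_notMem_tsupport fun h => lt_irrefl (0 : ℝ) (hs h)
      simp [this]
    · rw [← integral_exp_mul_bilateralLaplace hf hc c, ← integral_const_mul]
      refine integral_congr_ae (Eventually.of_forall fun ξ => ?_)
      have hn' : (n : ℂ) ≠ 0 := by exact_mod_cast hn
      dsimp only
      rw [LSeries.term_of_ne_zero hn, Complex.cpow_def_of_ne_zero hn', div_eq_mul_inv,
        ← Complex.exp_neg, Complex.natCast_log, mul_assoc, mul_comm (Complex.log _)]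
  have key := hasSum_integral_of_summable_integral_norm hFi (by
    simp_rw [norm_mul, hnorm, integral_const_mul]
    exact hsn.mul_right _)
  simp_rw [h1, tsum_mul_right] at key
  refine ⟨?_, key⟩
  refine (hi.norm.const_mul (∑' n, ‖LSeries.term b c n‖)).mono' ?_
    (Eventually.of_forall fun ξ => ?_)
  · refine (Continuous.mul ?_ hcl).aestronglyMeasurable
    unfold LSeries
    exact continuous_tsum hterm hsn fun n ξ => (hnorm n ξ).le
  · rw [norm_mul]
    gcongr
    refine (norm_tsum_le_tsum_norm ?_).trans (le_of_eq ?_)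
    · simp_rw [hnorm]; exact hsn
    · simp_rw [hnorm]

theorem logMul_iterate_apply (b : ℕ → ℂ) (K n : ℕ) :
    (LSeries.logMul^[K] b) n = (Real.log n : ℂ) ^ K * b n := by
  induction K with
  | zero => simp
  | succ K ih =>
    rw [Function.iterate_succ_apply', LSeries.logMul, ih, Complex.natCast_log, pow_succ]
    ring

/-- The explicit formula for test functions supported in `(1, ∞)`, in logarithmic coordinates. -/
theorem hasSum_zeros_explicit_formula {F : ℂ → ℂ} (hF : IsEntireOfFiniteOrder F) {m : ℕ}
    {b : ℕ → ℂ} (hb : LSeries.abscissaOfAbsConv b ≤ 1) (hne : ∀ s : ℂ, 1 < s.re → F s ≠ 0)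
    (hlog : ∀ s : ℂ, 1 < s.re → logDeriv F s = m / (s - 1) - LSeries b s)
    {f : ℝ → ℂ} (hf : ContDiff ℝ ∞ f) (hc : HasCompactSupport f) (hs : tsupport f ⊆ Ioi 0) :
    HasSum (fun ρ => (analyticOrderNatAt F ρ : ℂ) * bilateralLaplace f ρ)
      (m * bilateralLaplace f 1 - ∑' n : ℕ, b n * f (Real.log n)) := by
  obtain ⟨C, K, hC, hg⟩ := hF.exists_hasExpGrowth
  have hFd := hF.1
  -- Differentiating `K` times multiplies by `y ^ K` on the test function side; dividing beforehand
  -- compensates, and is harmless because the support avoids zero.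
  set f₁ : ℝ → ℂ := fun y => f y / (y : ℂ) ^ K with hf₁
  have hf₁d : ContDiff ℝ ∞ f₁ := contDiff_div_pow hf hs K
  have hts := tsupport_div_pow_subset f K
  have hf₁s : tsupport f₁ ⊆ Ioi 0 := hts.trans hs
  have hf₁c : HasCompactSupport f₁ := hc.of_isClosed_subset (isClosed_tsupport _) hts
  have hff : (fun y : ℝ => (y : ℂ) ^ K * f₁ y) = f := by
    ext y
    by_cases hy : y ∈ tsupport f
    · have hy0 : (y : ℂ) ≠ 0 := by exact_mod_cast (hs hy).ne'
      simp only [hf₁]; field_simp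
    · simp [hf₁, image_eq_zero_of_notMem_tsupport hy]
  have hfac : (K.factorial : ℂ) ≠ 0 := by exact_mod_cast K.factorial_ne_zero
  have hw3 : F 3 ≠ 0 := hne 3 (by norm_num)
  have hm := summable_analyticOrderNatAt_div hFd hC hg hw3
  -- The zeros lie in `re ρ ≤ 1`, so `c = 3` leaves more than the required unit distance.
  have key := hasSum_integral_partial_fractions hm (a := 1) (c := 3) (by norm_num)
    (fun ρ hρ => by
      by_contra! h
      exact hρ (analyticOrderNatAt_eq_zero_of_ne (hne ρ h))) hf₁d hf₁c hf₁s
  rw [hff] at key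
  have habs : ∀ s : ℂ, 1 < s.re → LSeries.abscissaOfAbsConv b < s.re := fun s h =>
    hb.trans_lt (by exact_mod_cast h)
  -- The derivative of order `K` of `F'/F` is computed in two ways: by partial fractions, and from
  -- the pole and the Dirichlet series.
  have hder : ∀ w : ℂ, 1 < w.re → ∑' ρ, (analyticOrderNatAt F ρ : ℂ) / (w - ρ) ^ (K + 1) =
      m * (1 / (w - 1) ^ (K + 1)) - 1 / K.factorial * LSeries (LSeries.logMul^[K] b) w := by
    intro w hw
    rw [(hasSum_analyticOrderNatAt_div_sub_pow hFd hC hg (hne w hw)).tsum_eq]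
    have hw1 : w - 1 ≠ 0 := by
      intro h0
      have := congrArg Complex.re h0
      simp at this; linarith
    have hev : logDeriv F =ᶠ[𝓝 w] (fun s => (m : ℂ) * (s - 1)⁻¹) - LSeries b := by
      filter_upwards [(isOpen_lt continuous_const Complex.continuous_re).mem_nhds hw] with s h
      rw [hlog s h, Pi.sub_apply, div_eq_mul_inv]
    have hinv : ContDiffAt ℂ K (fun s : ℂ => (s - 1)⁻¹) w :=
      (contDiffAt_id.sub contDiffAt_const).inv hw1
    have hLa : AnalyticAt ℂ (LSeries b) w := LSeries_analyticOnNhd b w (habs w hw)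
    rw [hev.iteratedDeriv_eq, iteratedDeriv_sub (contDiffAt_const.mul hinv) hLa.contDiffAt,
      iteratedDeriv_const_mul _ hinv, iteratedDeriv_inv_sub, LSeries_iteratedDeriv K (habs w hw)]
    have hsq : ((-1 : ℂ) ^ K) * (-1) ^ K = 1 := by rw [← mul_pow]; simp
    field_simp
    linear_combination (m * K.factorial - (w - 1) ^ (K + 1) * LSeries (LSeries.logMul^[K] b) w) * hsq
  have hL : LSeriesSummable (LSeries.logMul^[K] b) ((3 : ℝ) : ℂ) := by
    apply LSeriesSummable_of_abscissaOfAbsConv_lt_re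
    rw [LSeries.absicssaOfAbsConv_logPowMul]
    exact habs _ (by norm_num)
  obtain ⟨hLi, hLs⟩ := integral_LSeries_mul_bilateralLaplace hL hf₁d hf₁c hf₁s
  have hpole := integral_inv_sub_pow_mul_bilateralLaplace hf₁d hf₁c hf₁s (c := 3) (ρ := 1)
    (by norm_num) K
  rw [hff] at hpole
  have hne1 : ∀ ξ, (1 : ℝ) ≤ ‖verticalLine 3 ξ - 1‖ := fun ξ => by
    refine le_trans ?_ ((le_abs_self _).trans (Complex.abs_re_le_norm _))
    rw [Complex.sub_re, verticalLine_re]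
    norm_num
  have hpi : Integrable fun ξ => 1 / (verticalLine 3 ξ - 1) ^ (K + 1) *
      bilateralLaplace f₁ (verticalLine 3 ξ) := by
    have hl := continuous_verticalLine 3
    have hcl := continuous_bilateralLaplace_verticalLine hf₁d.continuous hf₁c 3
    refine (integrable_bilateralLaplace_verticalLine hf₁d hf₁c 3).norm.mono'
      ((continuous_const.div (by fun_prop) fun ξ => ?_).mul hcl).aestronglyMeasurable
      (Eventually.of_forall fun ξ => ?_)
    · exact pow_ne_zero _ (norm_pos_iff.1 (zero_lt_one.trans_le (hne1 ξ)))
    · rw [norm_mul, norm_div, norm_one, norm_pow]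
      refine mul_le_of_le_one_left (norm_nonneg _) (div_le_one_of_le₀ ?_ (by positivity))
      exact one_le_pow₀ (hne1 ξ)
  have hval : ∫ ξ, (∑' ρ, (analyticOrderNatAt F ρ : ℂ) / (verticalLine 3 ξ - ρ) ^ (K + 1)) *
      bilateralLaplace f₁ (verticalLine 3 ξ) =
      1 / K.factorial * (m * bilateralLaplace f 1 - ∑' n : ℕ, b n * f (Real.log n)) := by
    have h1 : ∀ ξ, (∑' ρ, (analyticOrderNatAt F ρ : ℂ) / (verticalLine 3 ξ - ρ) ^ (K + 1)) *
        bilateralLaplace f₁ (verticalLine 3 ξ) =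
        m * (1 / (verticalLine 3 ξ - 1) ^ (K + 1) * bilateralLaplace f₁ (verticalLine 3 ξ)) -
        1 / K.factorial * (LSeries (LSeries.logMul^[K] b) (verticalLine 3 ξ) *
          bilateralLaplace f₁ (verticalLine 3 ξ)) := by
      intro ξ
      rw [hder _ (by simp)]
      ring
    have h2 : ∑' n : ℕ, (LSeries.logMul^[K] b) n * f₁ (Real.log n) =
        ∑' n : ℕ, b n * f (Real.log n) := by
      refine tsum_congr fun n => ?_
      rw [logMul_iterate_apply, ← congrFun hff (Real.log n)]
      ring
    simp_rw [h1]
    rw [integral_sub (hpi.const_mul _) (hLi.const_mul _), integral_const_mul, integral_const_mul,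
      hpole, ← hLs.tsum_eq, h2]
    ring
  rw [hval] at key
  have hmul := key.mul_left (K.factorial : ℂ)
  rw [← mul_assoc, mul_one_div_cancel hfac, one_mul] at hmul
  have hfun : (fun ρ => (K.factorial : ℂ) * ((analyticOrderNatAt F ρ : ℂ) * (1 / K.factorial *
      bilateralLaplace f ρ))) = fun ρ => (analyticOrderNatAt F ρ : ℂ) * bilateralLaplace f ρ := by
    ext ρ
    field_simp
  rwa [hfun] at hmul

noncomputable section

/-! ### Zeros of completed L-functions -/

/-- The reciprocal of a gamma factor, an entire function. -/
def GammaFactor.recip (G : GammaFactor) (s : ℂ) : ℂ :=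
  (G.Q : ℂ) ^ (-s) * ∏ j, (Complex.Gamma (G.lam j * s + G.mu j))⁻¹

theorem GammaFactor.Q_ne_zero (G : GammaFactor) : (G.Q : ℂ) ≠ 0 := by
  exact_mod_cast G.Q_pos.ne'

theorem GammaFactor.differentiable_recip (G : GammaFactor) : Differentiable ℂ G.recip := by
  have h1 : Differentiable ℂ fun s : ℂ => (G.Q : ℂ) ^ (-s) := fun s =>
    (differentiableAt_id.neg).const_cpow (Or.inl G.Q_ne_zero)
  refine h1.mul (Differentiable.fun_finsetProd fun j _ => ?_)
  exact Complex.differentiable_one_div_Gamma.comp (f := fun s : ℂ => G.lam j * s + G.mu j)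
    (by fun_prop)

theorem GammaFactor.complete_eq (G : GammaFactor) (L : ℂ → ℂ) (s : ℂ) :
    G.complete L s = (G.recip s)⁻¹ * L s := by
  rw [GammaFactor.complete, GammaFactor.recip, mul_inv, Complex.cpow_neg, inv_inv,
    Finset.prod_inv_distrib, inv_inv]

theorem GammaFactor.recip_ne_zero (G : GammaFactor) {s : ℂ} (hs : 0 < s.re) : G.recip s ≠ 0 := by
  refine mul_ne_zero ?_ (Finset.prod_ne_zero_iff.2 fun j _ => inv_ne_zero ?_)
  · simp [Complex.cpow_eq_zero_iff, G.Q_ne_zero]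
  · apply Complex.Gamma_ne_zero_of_re_pos
    have h1 := mul_pos (G.lam_pos j) hs
    have h2 := G.mu_re_nonneg j
    simp only [Complex.add_re, Complex.re_ofReal_mul]
    linarith

theorem GammaFactor.regularAt_of_recip_ne_zero (G : GammaFactor) {s : ℂ} (hs : G.recip s ≠ 0) :
    G.RegularAt s := by
  intro j k hjk
  apply hs
  refine mul_eq_zero_of_right _ (Finset.prod_eq_zero (Finset.mem_univ j) ?_)
  rw [hjk, Complex.Gamma_neg_nat_eq_zero, inv_zero]

theorem eventually_nhdsNE_ne_zero_of_entire {F : ℂ → ℂ} (hF : Differentiable ℂ F) {w : ℂ}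
    (hw : F w ≠ 0) (ρ : ℂ) : ∀ᶠ s in 𝓝[≠] ρ, F s ≠ 0 := by
  rcases (hF.analyticAt ρ).eventually_eq_zero_or_eventually_ne_zero with h | h
  · exact absurd (analyticOrderAt_eq_top.2 h) (analyticOrderAt_ne_top_of_entire hF hw ρ)
  · exact h

variable {L F : ℂ → ℂ} {m : ℕ}

/-- Meromorphic orders see only punctured neighbourhoods, so the arbitrary value `L 1` and the
values at poles of the gamma factor play no role. -/
theorem complete_eventuallyEq (G : GammaFactor) (hFL : ∀ s, s ≠ 1 → F s = (s - 1) ^ m * L s)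
    (ρ : ℂ) : G.complete L =ᶠ[𝓝[≠] ρ] (G.recip)⁻¹ * ((fun s => (s - 1) ^ m)⁻¹ * F) := by
  have h1 : ∀ᶠ s in 𝓝[≠] ρ, s ≠ 1 := by
    rcases eq_or_ne ρ 1 with rfl | h
    · exact eventually_mem_nhdsWithin
    · exact eventually_nhdsWithin_of_eventually_nhds (eventually_ne_nhds h)
  filter_upwards [h1] with s hs
  have hs' : s - 1 ≠ 0 := sub_ne_zero.2 hs
  rw [G.complete_eq, Pi.mul_apply, Pi.mul_apply, Pi.inv_apply, Pi.inv_apply, hFL s hs]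
  field_simp

theorem meromorphicAt_complete (G : GammaFactor) (hF : Differentiable ℂ F)
    (hFL : ∀ s, s ≠ 1 → F s = (s - 1) ^ m * L s) (ρ : ℂ) : MeromorphicAt (G.complete L) ρ := by
  refine MeromorphicAt.congr ?_ (complete_eventuallyEq G hFL ρ).symm
  have h1 : AnalyticAt ℂ (fun s : ℂ => (s - 1) ^ m) ρ := by fun_prop
  exact (G.differentiable_recip.analyticAt ρ).meromorphicAt.inv.mul
    (h1.meromorphicAt.inv.mul (hF.analyticAt ρ).meromorphicAt)

theorem meromorphicOrderAt_eq_analyticOrderNatAt (hF : Differentiable ℂ F) {w : ℂ} (hw : F w ≠ 0)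
    (ρ : ℂ) : meromorphicOrderAt F ρ = ((analyticOrderNatAt F ρ : ℤ) : WithTop ℤ) := by
  rw [(hF.analyticAt ρ).meromorphicOrderAt_eq,
    ← Nat.cast_analyticOrderNatAt (analyticOrderAt_ne_top_of_entire hF hw ρ)]
  rfl

theorem meromorphicOrderAt_complete (G : GammaFactor) (hF : Differentiable ℂ F) {w : ℂ}
    (hw : F w ≠ 0) (hFL : ∀ s, s ≠ 1 → F s = (s - 1) ^ m * L s) (ρ : ℂ) :
    meromorphicOrderAt (G.complete L) ρ = (((analyticOrderNatAt F ρ : ℤ) -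
      (if ρ = 1 then (m : ℤ) else 0) - (analyticOrderNatAt G.recip ρ : ℤ) : ℤ) : WithTop ℤ) := by
  have h1 : AnalyticAt ℂ (fun s : ℂ => (s - 1) ^ m) ρ := by fun_prop
  have hG := G.differentiable_recip
  rw [meromorphicOrderAt_congr (complete_eventuallyEq G hFL ρ),
    meromorphicOrderAt_mul (hG.analyticAt ρ).meromorphicAt.inv
      (h1.meromorphicAt.inv.mul (hF.analyticAt ρ).meromorphicAt),
    meromorphicOrderAt_mul h1.meromorphicAt.inv (hF.analyticAt ρ).meromorphicAt,
    meromorphicOrderAt_inv, meromorphicOrderAt_inv,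
    meromorphicOrderAt_eq_analyticOrderNatAt hF hw,
    meromorphicOrderAt_eq_analyticOrderNatAt hG (G.recip_ne_zero (s := 1) (by simp))]
  have h2 : meromorphicOrderAt (fun s : ℂ => (s - 1) ^ m) ρ =
      ((if ρ = 1 then (m : ℤ) else 0 : ℤ) : WithTop ℤ) := by
    split_ifs with h
    · subst h
      exact meromorphicOrderAt_pow_id_sub_const
    · have h0 : (ρ - 1) ^ m ≠ 0 := pow_ne_zero _ (sub_ne_zero.2 h)
      rw [h1.meromorphicOrderAt_eq, h1.analyticOrderAt_eq_zero.2 h0]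
      rfl
  rw [h2]
  have hneg : ∀ a : ℤ, -(a : WithTop ℤ) = ((-a : ℤ) : WithTop ℤ) := fun a => rfl
  rw [hneg, hneg, ← WithTop.coe_add, ← WithTop.coe_add]
  congr 1
  ring

theorem zeroMultiplicity_complete_le (G : GammaFactor) (hF : Differentiable ℂ F) {w : ℂ}
    (hw : F w ≠ 0) (hFL : ∀ s, s ≠ 1 → F s = (s - 1) ^ m * L s) (ρ : ℂ) :
    zeroMultiplicity (G.complete L) ρ ≤ analyticOrderNatAt F ρ := by
  rw [zeroMultiplicity, meromorphicOrderAt_complete G hF hw hFL]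
  simp only [WithTop.untop₀_coe]
  split_ifs <;> omega

/-- The gamma factor has neither zeros nor poles in `re ρ > 0`, and at `ρ = 1` the condition `hm`
prevents the pole from hiding a zero of `F`. -/
theorem zeroMultiplicity_complete_eq (G : GammaFactor) (hF : Differentiable ℂ F) {w : ℂ}
    (hw : F w ≠ 0) (hFL : ∀ s, s ≠ 1 → F s = (s - 1) ^ m * L s) (hm : m = 0 ∨ F 1 ≠ 0) {ρ : ℂ}
    (hρ : 0 < ρ.re) : zeroMultiplicity (G.complete L) ρ = analyticOrderNatAt F ρ := by
  rw [zeroMultiplicity, meromorphicOrderAt_complete G hF hw hFL]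
  simp only [WithTop.untop₀_coe]
  rw [analyticOrderNatAt_eq_zero_of_ne (G.recip_ne_zero hρ)]
  split_ifs with h
  · subst h
    rcases hm with rfl | hm
    · simp
    · rw [analyticOrderNatAt_eq_zero_of_ne hm]; omega
  · simp

/-- The functional equation excludes zeros of the completed function to the left of the critical
strip. -/
theorem zeroMultiplicity_complete_eq_zero (G : GammaFactor) (hG : G.FunctionalEquation L)
    (hF : Differentiable ℂ F) (hFL : ∀ s, s ≠ 1 → F s = (s - 1) ^ m * L s)
    (hne : ∀ s : ℂ, 1 < s.re → F s ≠ 0) {ρ : ℂ} (hρ : ρ.re < 0) :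
    zeroMultiplicity (G.complete L) ρ = 0 := by
  obtain ⟨w, hw, hfe⟩ := hG
  set P : ℂ → ℂ := fun s => (G.recip s)⁻¹ * (((s - 1) ^ m)⁻¹ * F s) with hP
  set σ : ℂ := 1 - conj ρ with hσ
  have hσre : 1 < σ.re := by simp [hσ]; linarith
  have hσ1 : σ - 1 ≠ 0 := by
    intro h
    have := congrArg Complex.re h
    simp at this; linarith
  have hPσ : P σ ≠ 0 := mul_ne_zero (inv_ne_zero (G.recip_ne_zero (by linarith)))
    (mul_ne_zero (inv_ne_zero (pow_ne_zero _ hσ1)) (hne σ hσre))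
  have hPc : ContinuousAt P σ := by
    refine ContinuousAt.mul ?_ (ContinuousAt.mul ?_ hF.continuous.continuousAt)
    · exact G.differentiable_recip.continuous.continuousAt.inv₀ (G.recip_ne_zero (by linarith))
    · exact ContinuousAt.inv₀ (by fun_prop) (pow_ne_zero _ hσ1)
  have hcompP : ∀ s : ℂ, 1 < s.re → G.complete L s = P s := by
    intro s hs
    have h1 : s ≠ 1 := by rintro rfl; simp at hs
    have h2 : s - 1 ≠ 0 := sub_ne_zero.2 h1
    rw [G.complete_eq, hP]
    simp only
    rw [hFL s h1]
    field_simp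
  have hrecip : ∀ᶠ s in 𝓝[≠] ρ, G.recip s ≠ 0 := eventually_nhdsNE_ne_zero_of_entire
    G.differentiable_recip (G.recip_ne_zero (s := 1) (by simp)) ρ
  -- The functional equation is available only at regular points, which fill a punctured
  -- neighbourhood of `ρ`. There it identifies the completed function with one that is continuous
  -- and nonzero at `ρ`.
  have hev : (fun s => w * conj (P (1 - conj s))) =ᶠ[𝓝[≠] ρ] G.complete L := by
    have hre : ∀ᶠ s in 𝓝[≠] ρ, s.re < 0 := eventually_nhdsWithin_of_eventually_nhds
      ((isOpen_lt Complex.continuous_re continuous_const).mem_nhds hρ)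
    filter_upwards [hrecip, hre] with s h1 h2
    have h3 : 1 < (1 - conj s).re := by simp; linarith
    rw [hfe s (by rintro rfl; simp at h2) (by rintro rfl; simp at h2; linarith)
      (G.regularAt_of_recip_ne_zero h1)
      (G.regularAt_of_recip_ne_zero (G.recip_ne_zero (by linarith))), hcompP _ h3]
  have hlim : Tendsto (G.complete L) (𝓝[≠] ρ) (𝓝 (w * conj (P σ))) := by
    refine Tendsto.congr' hev (Tendsto.mono_left ?_ nhdsWithin_le_nhds)
    have h4 : ContinuousAt (fun s : ℂ => 1 - conj s) ρ := by fun_prop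
    have h5 : Tendsto (fun s => P (1 - conj s)) (𝓝 ρ) (𝓝 (P σ)) :=
      Tendsto.comp (y := 𝓝 σ) hPc h4
    exact tendsto_const_nhds.mul ((Complex.continuous_conj.tendsto _).comp h5)
  have hw0 : w ≠ 0 := by rintro rfl; simp at hw
  rw [zeroMultiplicity, (tendsto_ne_zero_iff_meromorphicOrderAt_eq_zero
    (meromorphicAt_complete G hF hFL ρ)).1 ⟨_, mul_ne_zero hw0 (by simpa using hPσ), hlim⟩]
  rfl

end

/-! ### Growth of the Riemann zeta function -/

theorem isEntireOfFiniteOrder_of_le {F : ℂ → ℂ} (hF : Differentiable ℂ F) {C R : ℝ}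
    (h : ∀ s, R ≤ ‖s‖ → ‖F s‖ ≤ Real.exp (C * (1 + ‖s‖) ^ 2)) : IsEntireOfFiniteOrder F := by
  refine ⟨hF, 3, IsBigO.of_bound 1 ?_⟩
  have h1 : ∀ᶠ s : ℂ in Bornology.cobounded ℂ, max R (4 * |C| + 1) ≤ ‖s‖ :=
    tendsto_norm_cobounded_atTop.eventually_ge_atTop _
  filter_upwards [h1] with s hs
  have h2 := h s ((le_max_left _ _).trans hs)
  have h3 := (le_max_right _ _).trans hs
  rw [one_mul, Real.norm_of_nonneg (Real.exp_nonneg _)]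
  refine h2.trans (Real.exp_le_exp.2 ?_)
  have h4 : ‖s‖ ^ (3 : ℝ) = ‖s‖ ^ 3 := by norm_cast
  rw [h4]
  have h5 : 1 ≤ ‖s‖ := by linarith [abs_nonneg C]
  calc C * (1 + ‖s‖) ^ 2 ≤ |C| * (‖s‖ + ‖s‖) ^ 2 := by
        gcongr
        exact le_abs_self C
    _ = (4 * |C|) * ‖s‖ ^ 2 := by ring
    _ ≤ ‖s‖ * ‖s‖ ^ 2 := by gcongr; linarith
    _ = ‖s‖ ^ 3 := by ring

/-- The reciprocal of the Gamma function has order at most two. -/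
theorem exists_norm_inv_Gamma_le :
    ∃ C : ℝ, 0 ≤ C ∧ ∀ z : ℂ, ‖(Complex.Gamma z)⁻¹‖ ≤ Real.exp (C * (1 + ‖z‖) ^ 2) := by
  have hsum : Summable fun n : ℕ => 1 / ((n : ℝ) + 1) ^ 2 := by
    have := (summable_nat_add_iff 1).2 (Real.summable_one_div_nat_pow.2 (one_lt_two))
    exact_mod_cast this
  set c := ∑' n : ℕ, 1 / ((n : ℝ) + 1) ^ 2 with hc
  have hc0 : 0 ≤ c := tsum_nonneg fun n => by positivity
  refine ⟨2 + c, by positivity, fun z => ?_⟩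
  by_cases hz : Complex.Gamma z = 0
  · rw [hz]; simp [Real.exp_nonneg]
  have hlim := ((Complex.GammaSeq_tendsto_Gamma z).inv₀ hz).norm
  refine le_of_tendsto hlim ?_
  filter_upwards [eventually_ge_atTop 1] with n hn
  have hn0 : (0 : ℝ) < n := by exact_mod_cast hn
  -- Apply `1 + t ≤ exp t` to `|1 + z / k| ^ 2 = 1 + 2 re z / k + |z| ^ 2 / k ^ 2` with `k = j + 1`.
  have hterm : ∀ j : ℕ, ‖z + (j + 1 : ℕ)‖ ≤
      (j + 1) * Real.exp (z.re / (j + 1) + ‖z‖ ^ 2 * (1 / ((j : ℝ) + 1) ^ 2)) := by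
    intro j
    have hj : (0 : ℝ) < j + 1 := by positivity
    have h1 : ‖z + (j + 1 : ℕ)‖ ^ 2 ≤ ((j + 1) *
        Real.exp (z.re / (j + 1) + ‖z‖ ^ 2 * (1 / ((j : ℝ) + 1) ^ 2))) ^ 2 := by
      rw [mul_pow, ← Real.exp_nat_mul]
      have h2 : ‖z + (j + 1 : ℕ)‖ ^ 2 = ((j : ℝ) + 1) ^ 2 *
          (2 * z.re / (j + 1) + ‖z‖ ^ 2 * (1 / ((j : ℝ) + 1) ^ 2) + 1) := by
        rw [Complex.sq_norm, Complex.sq_norm, Complex.normSq_apply, Complex.normSq_apply]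
        simp only [Complex.add_re, Complex.add_im, Complex.natCast_re, Complex.natCast_im]
        push_cast
        field_simp
        ring
      rw [h2]
      gcongr
      refine (Real.add_one_le_exp _).trans (Real.exp_le_exp.2 ?_)
      have h3 : 0 ≤ ‖z‖ ^ 2 * (1 / ((j : ℝ) + 1) ^ 2) := by positivity
      push_cast
      linarith [show 2 * z.re / ((j : ℝ) + 1) = 2 * (z.re / (j + 1)) by ring]
    exact le_of_sq_le_sq h1 (by positivity)
  have hprod : ‖∏ j ∈ Finset.range (n + 1), (z + j)‖ ≤ ‖z‖ * (n.factorial *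
      Real.exp (z.re * (harmonic n : ℝ) + ‖z‖ ^ 2 * c)) := by
    rw [norm_prod, Finset.prod_range_succ', mul_comm]
    simp only [Nat.cast_zero, add_zero]
    gcongr
    calc ∏ j ∈ Finset.range n, ‖z + (j + 1 : ℕ)‖ ≤ ∏ j ∈ Finset.range n,
          (((j + 1 : ℕ) : ℝ) * Real.exp (z.re / (j + 1) + ‖z‖ ^ 2 * (1 / ((j : ℝ) + 1) ^ 2))) := by
          refine Finset.prod_le_prod (fun _ _ => norm_nonneg _) fun j _ => ?_
          have := hterm j
          push_cast at this ⊢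
          exact this
      _ = n.factorial * Real.exp (z.re * (harmonic n : ℝ) +
          ‖z‖ ^ 2 * ∑ j ∈ Finset.range n, 1 / ((j : ℝ) + 1) ^ 2) := by
          rw [Finset.prod_mul_distrib, ← Real.exp_sum, ← Finset.prod_range_add_one_eq_factorial,
            Finset.sum_add_distrib, ← Finset.mul_sum]
          push_cast
          congr 3
          rw [harmonic, Rat.cast_sum, Finset.mul_sum]
          refine Finset.sum_congr rfl fun j _ => ?_
          push_cast
          rw [div_eq_mul_inv]
      _ ≤ _ := by
          gcongr
          exact hsum.sum_le_tsum _ fun _ _ => by positivity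
  -- The harmonic sum produced by the factors cancels `n ^ z` in `GammaSeq` up to a bounded
  -- exponent, so the estimate survives the limit.
  have hharm : |(harmonic n : ℝ) - Real.log n| ≤ 1 := by
    have h1 := harmonic_le_one_add_log n
    have h2 := log_add_one_le_harmonic n
    have h3 : Real.log n ≤ Real.log (n + 1 : ℕ) := by
      apply Real.log_le_log hn0; push_cast; linarith
    rw [abs_le]
    constructor <;> linarith
  have hfac : (0 : ℝ) < n.factorial := by exact_mod_cast n.factorial_pos
  rw [Complex.GammaSeq, norm_inv, norm_div, inv_div, norm_mul, Complex.norm_natCast,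
    Complex.norm_natCast_cpow_of_pos hn]
  calc _ ≤ ‖z‖ * (n.factorial * Real.exp (z.re * (harmonic n : ℝ) + ‖z‖ ^ 2 * c)) /
        ((n : ℝ) ^ z.re * n.factorial) := by gcongr
    _ = ‖z‖ * Real.exp (z.re * ((harmonic n : ℝ) - Real.log n) + ‖z‖ ^ 2 * c) := by
        rw [Real.rpow_def_of_pos hn0, mul_sub, sub_add_eq_add_sub, Real.exp_sub, mul_comm z.re]
        field_simp
    _ ≤ Real.exp ‖z‖ * Real.exp (‖z‖ + ‖z‖ ^ 2 * c) := by
        gcongr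
        · linarith [Real.add_one_le_exp ‖z‖]
        · calc z.re * ((harmonic n : ℝ) - Real.log n) ≤
                |z.re * ((harmonic n : ℝ) - Real.log n)| := le_abs_self _
            _ = |z.re| * |(harmonic n : ℝ) - Real.log n| := abs_mul _ _
            _ ≤ ‖z‖ * 1 := by
                gcongr
                exact Complex.abs_re_le_norm z
            _ = ‖z‖ := mul_one _
    _ = Real.exp (2 * ‖z‖ + ‖z‖ ^ 2 * c) := by rw [← Real.exp_add]; ring_nf
    _ ≤ _ := by
        apply Real.exp_le_exp.2
        nlinarith [norm_nonneg z, mul_nonneg hc0 (norm_nonneg z)]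

/-- In the strip, `t ^ (re s - 1)` is at most the sum of the powers at the two edges, one serving `t
≤ 1` and the other `t ≥ 1`. -/
theorem exists_norm_mellin_le {f : ℝ → ℂ} (hf : ∀ s, MellinConvergent f s) (a b : ℝ) :
    ∃ M : ℝ, ∀ s : ℂ, a ≤ s.re → s.re ≤ b → ‖mellin f s‖ ≤ M := by
  have hn : ∀ c : ℝ, IntegrableOn (fun t : ℝ => t ^ (c - 1) * ‖f t‖) (Ioi 0) := by
    intro c
    refine Integrable.congr (hf c).norm ((ae_restrict_mem measurableSet_Ioi).mono fun t ht => ?_)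
    simp only [norm_smul]
    rw [Complex.norm_cpow_eq_rpow_re_of_pos ht]
    simp
  refine ⟨(∫ t in Ioi (0 : ℝ), t ^ (a - 1) * ‖f t‖) + ∫ t in Ioi (0 : ℝ), t ^ (b - 1) * ‖f t‖,
    fun s ha hb => ?_⟩
  rw [← integral_add (hn a) (hn b), mellin]
  refine norm_integral_le_of_norm_le ((hn a).add (hn b)) ?_
  filter_upwards [ae_restrict_mem measurableSet_Ioi] with t ht
  rw [norm_smul, Complex.norm_cpow_eq_rpow_re_of_pos ht, ← add_mul]
  gcongr
  have ht' : (0 : ℝ) < t := ht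
  simp only [Complex.sub_re, Complex.one_re]
  rcases le_total t 1 with h | h
  · have h1 := Real.rpow_le_rpow_of_exponent_ge ht' h (show a - 1 ≤ s.re - 1 by linarith)
    have := Real.rpow_nonneg ht'.le (b - 1)
    linarith
  · have h1 := Real.rpow_le_rpow_of_exponent_le h (show s.re - 1 ≤ b - 1 by linarith)
    have := Real.rpow_nonneg ht'.le (a - 1)
    linarith

theorem exists_norm_completedRiemannZeta₀_le_strip (a b : ℝ) :
    ∃ M : ℝ, ∀ s : ℂ, a ≤ s.re → s.re ≤ b → ‖completedRiemannZeta₀ s‖ ≤ M := by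
  obtain ⟨M, hM⟩ := exists_norm_mellin_le (f := (HurwitzZeta.hurwitzEvenFEPair 0).f_modif)
    (fun s => ((HurwitzZeta.hurwitzEvenFEPair 0).isStrongFEPair_toStrongFEPair.hasMellin s).1)
    (a / 2) (b / 2)
  refine ⟨M / 2, fun s ha hb => ?_⟩
  have h1 := hM (s / 2) (by simp; linarith) (by simp; linarith)
  have h2 : completedRiemannZeta₀ s =
    mellin (HurwitzZeta.hurwitzEvenFEPair 0).f_modif (s / 2) / 2 := rfl
  rw [h2, norm_div]
  simp only [Complex.norm_ofNat]
  gcongr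

theorem norm_Gamma_le_Gamma_re {z : ℂ} (hz : 0 < z.re) : ‖Complex.Gamma z‖ ≤ Real.Gamma z.re := by
  rw [Complex.Gamma_eq_integral hz, Real.Gamma_eq_integral hz, Complex.GammaIntegral]
  refine (norm_integral_le_integral_norm _).trans (le_of_eq ?_)
  refine setIntegral_congr_fun measurableSet_Ioi fun t ht => ?_
  simp only [norm_mul]
  rw [Complex.norm_cpow_eq_rpow_re_of_pos ht, Complex.norm_real,
    Real.norm_of_nonneg (Real.exp_nonneg _)]
  simp

theorem norm_Gamma_le_exp {z : ℂ} (hz : 2 ≤ z.re) :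
    ‖Complex.Gamma z‖ ≤ Real.exp ((1 + ‖z‖) ^ 2) := by
  refine (norm_Gamma_le_Gamma_re (by linarith)).trans ?_
  set n := ⌈z.re⌉₊ with hn
  have h1 : z.re ≤ n := Nat.le_ceil _
  have h2 : (n : ℝ) ≤ 1 + ‖z‖ := by
    have := Nat.ceil_lt_add_one (show 0 ≤ z.re by linarith)
    linarith [Complex.re_le_norm z]
  have h3 : Real.Gamma z.re ≤ n.factorial := by
    rw [← Real.Gamma_nat_eq_factorial]
    exact Real.Gamma_strictMonoOn_Ici.monotoneOn hz (show (2 : ℝ) ≤ n + 1 by linarith) (by linarith)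
  calc Real.Gamma z.re ≤ n.factorial := h3
    _ ≤ (n : ℝ) ^ n := by exact_mod_cast n.factorial_le_pow
    _ ≤ (Real.exp n) ^ n := by
        gcongr
        linarith [Real.add_one_le_exp (n : ℝ)]
    _ = Real.exp ((n : ℝ) ^ 2) := by rw [← Real.exp_nat_mul, sq]
    _ ≤ _ := by gcongr

/-- The strip bound covers `-3 ≤ re s ≤ 4`. To its right one expands through `Gammaℝ s * ζ(s)`; the
edge 4 makes `re (s / 2) ≥ 2`, where the real Gamma function is monotone. The reflection `s ↦ 1 - s`
gives the left. -/
theorem exists_norm_completedRiemannZeta₀_le :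
    ∃ C : ℝ, 0 ≤ C ∧ ∀ s : ℂ, ‖completedRiemannZeta₀ s‖ ≤ Real.exp (C * (1 + ‖s‖) ^ 2) := by
  obtain ⟨M, hM⟩ := exists_norm_completedRiemannZeta₀_le_strip (-3) 4
  set Z := ∑' n : ℕ, ‖LSeries.term (1 : ℕ → ℂ) 2 n‖ with hZ
  have hZs : Summable fun n : ℕ => ‖LSeries.term (1 : ℕ → ℂ) 2 n‖ :=
    (LSeriesSummable_one_iff.2 (by norm_num)).norm
  have hZ0 : 0 ≤ Z := tsum_nonneg fun n => norm_nonneg _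
  have hright : ∀ s : ℂ, 4 ≤ s.re → ‖completedRiemannZeta₀ s‖ ≤
      Real.exp ((1 + ‖s‖) ^ 2) * Z + 2 := by
    intro s hs
    have hs0 : s ≠ 0 := by rintro rfl; simp at hs; linarith
    have h1 : completedRiemannZeta₀ s = Complex.Gammaℝ s * riemannZeta s + 1 / s + 1 / (1 - s) := by
      rw [riemannZeta_def_of_ne_zero hs0, mul_div_cancel₀ _
        (Complex.Gammaℝ_ne_zero_of_re_pos (by linarith)), completedRiemannZeta_eq]
      ring
    have h2 : ‖riemannZeta s‖ ≤ Z := by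
      rw [← LSeries_one_eq_riemannZeta (by linarith), LSeries]
      have h3 : ∀ n, ‖LSeries.term (1 : ℕ → ℂ) s n‖ ≤ ‖LSeries.term (1 : ℕ → ℂ) 2 n‖ := fun n =>
        LSeries.norm_term_le_of_re_le_re _ (by simp; linarith) n
      exact (norm_tsum_le_tsum_norm (hZs.of_nonneg_of_le (fun _ => norm_nonneg _) h3)).trans
        (Summable.tsum_le_tsum h3 (hZs.of_nonneg_of_le (fun _ => norm_nonneg _) h3) hZs)
    have h4 : ‖Complex.Gammaℝ s‖ ≤ Real.exp ((1 + ‖s‖) ^ 2) := by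
      rw [Complex.Gammaℝ_def, norm_mul, Complex.norm_cpow_eq_rpow_re_of_pos Real.pi_pos]
      have h5 : Real.pi ^ (-s / 2).re ≤ 1 := by
        apply Real.rpow_le_one_of_one_le_of_nonpos
        · linarith [Real.pi_gt_three]
        · simp; linarith
      have h6 := norm_Gamma_le_exp (z := s / 2) (by simp; linarith)
      have h7 : ‖s / 2‖ ≤ ‖s‖ := by
        rw [norm_div]; simp
      calc _ ≤ 1 * Real.exp ((1 + ‖s / 2‖) ^ 2) := by gcongr
        _ ≤ _ := by rw [one_mul]; gcongr
    have h8 : ‖1 / s‖ ≤ 1 := by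
      rw [norm_div, norm_one]
      exact div_le_one_of_le₀ (by linarith [Complex.re_le_norm s]) (norm_nonneg _)
    have h9 : ‖1 / (1 - s)‖ ≤ 1 := by
      rw [norm_div, norm_one]
      refine div_le_one_of_le₀ ?_ (norm_nonneg _)
      have := Complex.abs_re_le_norm (1 - s)
      rw [Complex.sub_re, Complex.one_re, abs_of_nonpos (by linarith)] at this
      linarith
    rw [h1]
    calc _ ≤ ‖Complex.Gammaℝ s‖ * ‖riemannZeta s‖ + ‖1 / s‖ + ‖1 / (1 - s)‖ := by
          refine (norm_add₃_le ..).trans ?_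
          rw [norm_mul]
      _ ≤ Real.exp ((1 + ‖s‖) ^ 2) * Z + 1 + 1 := by gcongr
      _ = _ := by ring
  have hexp : ∀ r : ℝ, 0 ≤ r → r ≤ Real.exp r := fun r _ => by linarith [Real.add_one_le_exp r]
  refine ⟨4 + Z + 2 + |M|, by positivity, fun s => ?_⟩
  have hs0 := norm_nonneg s
  have hbig : ∀ t : ℂ, ‖t‖ ≤ 1 + ‖s‖ → Real.exp ((1 + ‖t‖) ^ 2) * Z + 2 ≤
      Real.exp ((4 + Z + 2 + |M|) * (1 + ‖s‖) ^ 2) := by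
    intro t ht
    have h1 : (1 + ‖t‖) ^ 2 ≤ 4 * (1 + ‖s‖) ^ 2 := by
      have : 1 + ‖t‖ ≤ 2 * (1 + ‖s‖) := by linarith
      calc (1 + ‖t‖) ^ 2 ≤ (2 * (1 + ‖s‖)) ^ 2 := by gcongr
        _ = _ := by ring
    have h2 : (1 : ℝ) ≤ Real.exp (4 * (1 + ‖s‖) ^ 2) := Real.one_le_exp (by positivity)
    have h3 : (1 : ℝ) ≤ (1 + ‖s‖) ^ 2 := one_le_pow₀ (by linarith)
    calc Real.exp ((1 + ‖t‖) ^ 2) * Z + 2 ≤ Real.exp (4 * (1 + ‖s‖) ^ 2) * Z +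
          Real.exp (4 * (1 + ‖s‖) ^ 2) * 2 := by
          gcongr
          linarith
      _ = Real.exp (4 * (1 + ‖s‖) ^ 2) * (Z + 2) := by ring
      _ ≤ Real.exp (4 * (1 + ‖s‖) ^ 2) * Real.exp (Z + 2) := by
          gcongr
          exact hexp _ (by positivity)
      _ = Real.exp (4 * (1 + ‖s‖) ^ 2 + (Z + 2)) := by rw [← Real.exp_add]
      _ ≤ _ := by
          gcongr
          nlinarith [mul_le_mul_of_nonneg_left h3 (show 0 ≤ Z + 2 + |M| by positivity), abs_nonneg M]
  rcases le_total 4 s.re with h | h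
  · exact (hright s h).trans (hbig s (by linarith))
  rcases le_total (-3) s.re with h' | h'
  · refine (hM s h' h).trans ((le_abs_self M).trans ((hexp _ (abs_nonneg M)).trans ?_))
    gcongr
    have h3 : (1 : ℝ) ≤ (1 + ‖s‖) ^ 2 := one_le_pow₀ (by linarith)
    nlinarith [abs_nonneg M]
  · rw [← completedRiemannZeta₀_one_sub]
    refine (hright (1 - s) (by simp; linarith)).trans (hbig _ ?_)
    simpa using norm_sub_le (1 : ℂ) s

/-! ### The function `(s - 1) ζ(s)` and its zeros -/

noncomputable section

/-- The entire function `(s - 1) ζ(s)`. -/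
def zetaEntire : ℂ → ℂ := Function.update (fun s => (s - 1) * riemannZeta s) 1 1

theorem zetaEntire_of_ne {s : ℂ} (hs : s ≠ 1) : zetaEntire s = (s - 1) * riemannZeta s :=
  Function.update_of_ne hs _ _

theorem zetaEntire_one : zetaEntire 1 = 1 := Function.update_self _ _ _

theorem differentiable_zetaEntire : Differentiable ℂ zetaEntire := by
  have hd : ∀ s : ℂ, s ≠ 1 → DifferentiableAt ℂ zetaEntire s := by
    intro s hs
    refine DifferentiableAt.congr_of_eventuallyEq
      ((differentiableAt_id.sub_const 1).mul (differentiableAt_riemannZeta hs)) ?_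
    filter_upwards [eventually_ne_nhds hs] with z hz using zetaEntire_of_ne hz
  intro s
  rcases eq_or_ne s 1 with rfl | hs
  · refine (Complex.analyticAt_of_differentiable_on_punctured_nhds_of_continuousAt
      (eventually_mem_nhdsWithin.mono fun z hz => hd z hz) ?_).differentiableAt
    rw [zetaEntire, continuousAt_update_same]
    exact riemannZeta_residue_one
  · exact hd s hs

/-- Away from a disc the function is `(s - 1) * completedRiemannZeta s * (Gammaℝ s)⁻¹`, and each
factor is at most `exp (O((1 + ‖s‖) ^ 2))`. -/
theorem isEntireOfFiniteOrder_zetaEntire : IsEntireOfFiniteOrder zetaEntire := by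
  obtain ⟨A, hA, hΓ⟩ := exists_norm_inv_Gamma_le
  obtain ⟨B, hB, hΛ⟩ := exists_norm_completedRiemannZeta₀_le
  refine isEntireOfFiniteOrder_of_le differentiable_zetaEntire (C := 1 + (B + 2) + (Real.pi + A))
    (R := 2) fun s hs => ?_
  have hs0 : s ≠ 0 := by rintro rfl; simp at hs; linarith
  have hs1 : s ≠ 1 := by rintro rfl; simp at hs
  set T := (1 + ‖s‖) ^ 2 with hT
  have hT1 : 1 ≤ T := one_le_pow₀ (by linarith)
  have hsT : 1 + ‖s‖ ≤ T := by rw [hT]; nlinarith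
  have h1 : ‖s - 1‖ ≤ Real.exp (1 * T) := by
    calc ‖s - 1‖ ≤ ‖s‖ + 1 := by simpa using norm_sub_le s 1
      _ ≤ Real.exp (1 * T) := by linarith [Real.add_one_le_exp (1 * T)]
  have h2 : ‖completedRiemannZeta s‖ ≤ Real.exp ((B + 2) * T) := by
    rw [completedRiemannZeta_eq]
    have h3 : ‖1 / s‖ ≤ 1 := by
      rw [norm_div, norm_one]
      exact div_le_one_of_le₀ (by linarith) (norm_nonneg _)
    have h4 : ‖1 / (1 - s)‖ ≤ 1 := by
      rw [norm_div, norm_one]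
      refine div_le_one_of_le₀ ?_ (norm_nonneg _)
      have := norm_sub_norm_le s 1
      rw [norm_one, norm_sub_rev] at this
      linarith
    have h5 : 1 ≤ Real.exp (B * T) := Real.one_le_exp (by positivity)
    calc _ ≤ ‖completedRiemannZeta₀ s‖ + ‖1 / s‖ + ‖1 / (1 - s)‖ :=
          (norm_sub_le _ _).trans (by gcongr; exact norm_sub_le _ _)
      _ ≤ Real.exp (B * T) + 1 + 1 := by gcongr; exact hΛ s
      _ ≤ Real.exp (B * T) * Real.exp 2 := by nlinarith [Real.add_one_le_exp 2]
      _ = Real.exp (B * T + 2) := by rw [← Real.exp_add]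
      _ ≤ _ := by gcongr; linarith
  have h6 : ‖(Complex.Gammaℝ s)⁻¹‖ ≤ Real.exp ((Real.pi + A) * T) := by
    rw [Complex.Gammaℝ_def, mul_inv, norm_mul, ← Complex.cpow_neg,
      Complex.norm_cpow_eq_rpow_re_of_pos Real.pi_pos, add_mul, Real.exp_add]
    have hπ := Real.pi_gt_three
    gcongr
    · rw [Real.rpow_def_of_pos Real.pi_pos]
      have hre : (-(-s / 2)).re = s.re / 2 := by simp [neg_div]
      have hlog : Real.log Real.pi ≤ Real.pi :=
        (Real.log_le_sub_one_of_pos Real.pi_pos).trans (by linarith)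
      have hlog0 : 0 ≤ Real.log Real.pi := Real.log_nonneg (by linarith)
      have hsre : s.re / 2 ≤ T := by linarith [Complex.re_le_norm s]
      rw [hre]
      apply Real.exp_le_exp.2
      calc Real.log Real.pi * (s.re / 2) ≤ Real.log Real.pi * T := by gcongr
        _ ≤ Real.pi * T := by gcongr
    · refine (hΓ (s / 2)).trans ?_
      have h7 : ‖s / 2‖ ≤ ‖s‖ := by
        rw [norm_div]; simp
      rw [hT]
      gcongr
  rw [zetaEntire_of_ne hs1, riemannZeta_def_of_ne_zero hs0, div_eq_mul_inv, norm_mul, norm_mul,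
    add_mul, add_mul, Real.exp_add, Real.exp_add, ← mul_assoc]
  gcongr

theorem zetaEntire_ne_zero {s : ℂ} (hs : 1 ≤ s.re) : zetaEntire s ≠ 0 := by
  rcases eq_or_ne s 1 with rfl | h
  · rw [zetaEntire_one]; exact one_ne_zero
  · rw [zetaEntire_of_ne h]
    exact mul_ne_zero (sub_ne_zero.2 h) (riemannZeta_ne_zero_of_one_le_re hs)

theorem logDeriv_zetaEntire {s : ℂ} (hs : 1 < s.re) :
    logDeriv zetaEntire s = (1 : ℕ) / (s - 1) -
      LSeries (fun n => (ArithmeticFunction.vonMangoldt n : ℂ)) s := by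
  have h1 : s ≠ 1 := by rintro rfl; simp at hs
  have hev : zetaEntire =ᶠ[𝓝 s] fun z => (z - 1) * riemannZeta z := by
    filter_upwards [eventually_ne_nhds h1] with z hz using zetaEntire_of_ne hz
  have h2 : logDeriv zetaEntire s = logDeriv (fun z => (z - 1) * riemannZeta z) s := by
    rw [logDeriv_apply, logDeriv_apply, hev.deriv_eq, hev.eq_of_nhds]
  rw [h2, logDeriv_mul (f := fun z : ℂ => z - 1) s (sub_ne_zero.2 h1) (riemannZeta_ne_zero_of_one_le_re hs.le)
    (by fun_prop) (differentiableAt_riemannZeta h1),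
    ArithmeticFunction.LSeries_vonMangoldt_eq_deriv_riemannZeta_div hs, logDeriv_apply,
    logDeriv_apply]
  simp [neg_div]

theorem abscissaOfAbsConv_vonMangoldt_le :
    LSeries.abscissaOfAbsConv (fun n => (ArithmeticFunction.vonMangoldt n : ℂ)) ≤ 1 := by
  refine LSeries.abscissaOfAbsConv_le_of_forall_lt_LSeriesSummable' fun y hy => ?_
  exact ArithmeticFunction.LSeriesSummable_vonMangoldt (by
    simpa using (EReal.coe_lt_coe_iff.1 (by simpa using hy) : (1 : ℝ) < y))

/-- In the closed left half-plane, `(s - 1) ζ(s)` vanishes only at the negative even integers. -/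
theorem zetaEntire_eq_zero_of_re_nonpos {ρ : ℂ} (hρ : ρ.re ≤ 0) (h : zetaEntire ρ = 0) :
    ρ.re ≤ -2 ∧ ‖ρ‖ = -ρ.re := by
  have h1 : ρ ≠ 1 := by rintro rfl; simp at hρ; linarith
  have h0 : ρ ≠ 0 := by
    rintro rfl
    rw [zetaEntire_of_ne h1, riemannZeta_zero] at h
    norm_num at h
  rw [zetaEntire_of_ne h1, riemannZeta_def_of_ne_zero h0] at h
  -- By reflection this is nonvanishing of `ζ` on `re s ≥ 1`; the zero must therefore come from a
  -- pole of `Gammaℝ`.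
  have hΛ : completedRiemannZeta ρ ≠ 0 := by
    rw [← completedRiemannZeta_one_sub]
    have h2 : 1 - ρ ≠ 0 := sub_ne_zero.2 (Ne.symm h1)
    have h3 := riemannZeta_ne_zero_of_one_le_re (s := 1 - ρ) (by simp; linarith)
    rw [riemannZeta_def_of_ne_zero h2] at h3
    exact (div_ne_zero_iff.1 h3).1
  have h4 : Complex.Gammaℝ ρ = 0 := by
    rcases mul_eq_zero.1 h with h5 | h5
    · exact absurd h5 (sub_ne_zero.2 h1)
    · exact (div_eq_zero_iff.1 h5).resolve_left hΛ
  obtain ⟨n, rfl⟩ := Complex.Gammaℝ_eq_zero_iff.1 h4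
  have hn : n ≠ 0 := by rintro rfl; simp at h0
  have hn1 : (1 : ℝ) ≤ n := by exact_mod_cast Nat.one_le_iff_ne_zero.2 hn
  constructor
  · simp only [Complex.neg_re, Complex.mul_re, Complex.re_ofNat, Complex.natCast_re,
      Complex.im_ofNat, Complex.natCast_im]
    linarith
  · simp

/-- The gamma factor of the Riemann zeta function. -/
def zetaGammaFactor : GammaFactor where
  Q := Real.pi ^ (-(1 / 2) : ℝ)
  r := 1
  lam := fun _ => 1 / 2
  mu := fun _ => 0
  Q_pos := Real.rpow_pos_of_pos Real.pi_pos _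
  one_le_r := le_rfl
  lam_pos := fun _ => by norm_num
  mu_re_nonneg := fun _ => by simp

theorem zetaGammaFactor_complete_eq (s : ℂ) :
    zetaGammaFactor.complete riemannZeta s = Complex.Gammaℝ s * riemannZeta s := by
  rw [GammaFactor.complete, Complex.Gammaℝ_def]
  congr 1
  have h : ∏ j : Fin zetaGammaFactor.r, Complex.Gamma
      (zetaGammaFactor.lam j * s + zetaGammaFactor.mu j) = Complex.Gamma (s / 2) := by
    change ∏ j : Fin 1, Complex.Gamma (((1 / 2 : ℝ) : ℂ) * s + 0) = _
    rw [Fin.prod_univ_one]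
    congr 1
    push_cast
    ring
  rw [h]
  congr 1
  change ((Real.pi ^ (-(1 / 2) : ℝ) : ℝ) : ℂ) ^ s = _
  have hπ : (Real.pi : ℂ) ≠ 0 := by exact_mod_cast Real.pi_ne_zero
  rw [Complex.cpow_def_of_ne_zero (by exact_mod_cast (Real.rpow_pos_of_pos Real.pi_pos _).ne'),
    Complex.cpow_def_of_ne_zero hπ, ← Complex.ofReal_log (Real.rpow_nonneg Real.pi_pos.le _),
    Real.log_rpow Real.pi_pos, ← Complex.ofReal_log Real.pi_pos.le]
  congr 1
  push_cast
  ring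

theorem completedRiemannZeta_eventuallyEq (ρ : ℂ) :
    completedRiemannZeta =ᶠ[𝓝[≠] ρ] zetaGammaFactor.complete riemannZeta := by
  have h1 := eventually_nhdsNE_ne_zero_of_entire Complex.differentiable_Gammaℝ_inv (w := 1)
    (inv_ne_zero (Complex.Gammaℝ_ne_zero_of_re_pos (by simp))) ρ
  have h2 : ∀ᶠ s in 𝓝[≠] ρ, s ≠ 0 := by
    rcases eq_or_ne ρ 0 with rfl | h
    · exact eventually_mem_nhdsWithin
    · exact eventually_nhdsWithin_of_eventually_nhds (eventually_ne_nhds h)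
  filter_upwards [h1, h2] with s hs1 hs2
  rw [zetaGammaFactor_complete_eq, riemannZeta_def_of_ne_zero hs2,
    mul_div_cancel₀ _ (by simpa using hs1)]

theorem zeroMultiplicity_completedRiemannZeta_eq (ρ : ℂ) :
    zeroMultiplicity completedRiemannZeta ρ =
      zeroMultiplicity (zetaGammaFactor.complete riemannZeta) ρ := by
  rw [zeroMultiplicity, zeroMultiplicity,
    meromorphicOrderAt_congr (completedRiemannZeta_eventuallyEq ρ)]

theorem zetaEntire_eq_pow_mul (s : ℂ) (hs : s ≠ 1) :
    zetaEntire s = (s - 1) ^ 1 * riemannZeta s := by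
  rw [pow_one, zetaEntire_of_ne hs]

theorem zeroMultiplicity_completedRiemannZeta_le (ρ : ℂ) :
    zeroMultiplicity completedRiemannZeta ρ ≤ analyticOrderNatAt zetaEntire ρ := by
  rw [zeroMultiplicity_completedRiemannZeta_eq]
  exact zeroMultiplicity_complete_le _ differentiable_zetaEntire
    (zetaEntire_ne_zero (s := 1) (by simp)) zetaEntire_eq_pow_mul ρ

theorem zeroMultiplicity_completedRiemannZeta_of_re_pos {ρ : ℂ} (hρ : 0 < ρ.re) :
    zeroMultiplicity completedRiemannZeta ρ = analyticOrderNatAt zetaEntire ρ := by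
  have h1 := zetaEntire_ne_zero (s := 1) (by simp)
  rw [zeroMultiplicity_completedRiemannZeta_eq]
  exact zeroMultiplicity_complete_eq _ differentiable_zetaEntire h1 zetaEntire_eq_pow_mul
    (Or.inr h1) hρ

theorem zeroMultiplicity_completedRiemannZeta_of_re_neg {ρ : ℂ} (hρ : ρ.re < 0) :
    zeroMultiplicity completedRiemannZeta ρ = 0 := by
  have h0 : ρ ≠ 0 := by rintro rfl; simp at hρ
  have h1 : ρ ≠ 1 := by rintro rfl; simp at hρ; linarith
  have hΛ : completedRiemannZeta ρ ≠ 0 := by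
    rw [← completedRiemannZeta_one_sub]
    have h3 := riemannZeta_ne_zero_of_one_le_re (s := 1 - ρ) (by simp; linarith)
    rw [riemannZeta_def_of_ne_zero (sub_ne_zero.2 (Ne.symm h1))] at h3
    exact (div_ne_zero_iff.1 h3).1
  have hm : MeromorphicAt completedRiemannZeta ρ :=
    (meromorphicAt_complete zetaGammaFactor differentiable_zetaEntire zetaEntire_eq_pow_mul
      ρ).congr (completedRiemannZeta_eventuallyEq ρ).symm
  have hlim : Tendsto completedRiemannZeta (𝓝[≠] ρ) (𝓝 (completedRiemannZeta ρ)) :=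
    (differentiableAt_completedZeta h0 h1).continuousAt.tendsto.mono_left nhdsWithin_le_nhds
  rw [zeroMultiplicity, (tendsto_ne_zero_iff_meromorphicOrderAt_eq_zero hm).1 ⟨_, hΛ, hlim⟩]
  rfl

end

/-! ### Dirichlet coefficients of a function with a rank one Euler product -/

theorem eq_zero_of_hasSum_pow_eq_zero {d : ℕ → ℂ}
    (h : ∀ᶠ z in 𝓝[≠] (0 : ℂ), HasSum (fun n => d n * z ^ n) 0) (n : ℕ) : d n = 0 := by
  have hs : ∀ᶠ z in 𝓝 (0 : ℂ), Summable fun n => d n * z ^ n := by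
    rw [eventually_nhdsWithin_iff] at h
    filter_upwards [h] with z hz
    rcases eq_or_ne z 0 with rfl | h0
    · exact summable_of_ne_finset_zero (s := {0}) fun k hk => by
        simp only [Finset.mem_singleton] at hk
        simp [hk]
    · exact (hz h0).summable
  set f : ℂ → ℂ := fun z => ∑' n, d n * z ^ n
  have hp : HasFPowerSeriesAt f (FormalMultilinearSeries.ofScalars ℂ d) 0 := by
    rw [hasFPowerSeriesAt_iff]
    filter_upwards [hs] with z hz
    simp only [FormalMultilinearSeries.coeff_ofScalars, zero_add, smul_eq_mul]
    simp_rw [mul_comm (z ^ _)]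
    exact hz.hasSum
  have hf : f =ᶠ[𝓝[≠] 0] fun _ => 0 := by
    filter_upwards [h] with z hz using hz.tsum_eq
  have hf0 : f =ᶠ[𝓝 0] fun _ => 0 := by
    have hfr : ∃ᶠ z in 𝓝[≠] (0 : ℂ), f z = 0 := hf.frequently
    exact (hp.analyticAt.frequently_zero_iff_eventually_zero).1 hfr
  have hz : HasFPowerSeriesAt (0 : ℂ → ℂ) (FormalMultilinearSeries.ofScalars ℂ d) 0 :=
    hp.congr hf0
  have := hz.eq_zero
  rw [← FormalMultilinearSeries.coeff_ofScalars (𝕜 := ℂ) (p := d) (n := n), this]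
  rfl

/-- As `s` varies over `re s > 0`, `z = p ^ (-s)` fills the punctured unit disc, so the hypothesis
compares two power series in `z`. The bound on `a` ensures genuine convergence for small `z`, where
the `tsum` is not a default value. -/
theorem apply_prime_pow_of_eulerFactor {a : ℕ → ℂ} {C : ℝ} (hC : ∀ n, n ≠ 0 → ‖a n‖ ≤ C * n ^ 2)
    {p : ℕ} (hp : p.Prime) {c : ℂ}
    (h : ∀ s : ℂ, 0 < s.re → eulerFactor a p s = (1 - c * (p : ℂ) ^ (-s))⁻¹) (k : ℕ) :
    a (p ^ k) = c ^ k := by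
  have hp0 : (p : ℂ) ≠ 0 := by exact_mod_cast hp.ne_zero
  have hp1 : (1 : ℝ) < p := by exact_mod_cast hp.one_lt
  have hlog : 0 < Real.log p := Real.log_pos hp1
  -- Both `‖a (p ^ k)‖ ≤ C * p ^ (2 * k)` and `‖c ^ k‖` are controlled by powers of this `A`.
  set A : ℝ := (p : ℝ) ^ 2 + ‖c‖ with hA
  have hA0 : 0 < A := by positivity
  rw [← sub_eq_zero]
  refine eq_zero_of_hasSum_pow_eq_zero (d := fun k => a (p ^ k) - c ^ k) ?_ k
  have h1 : ∀ᶠ z : ℂ in 𝓝[≠] 0, ‖z‖ < min 1 (1 / A) := by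
    refine eventually_nhdsWithin_of_eventually_nhds ?_
    have := Metric.ball_mem_nhds (0 : ℂ) (show 0 < min 1 (1 / A) by positivity)
    filter_upwards [this] with z hz using by simpa using hz
  filter_upwards [h1, eventually_mem_nhdsWithin] with z hz hz0
  have hz0' : z ≠ 0 := hz0
  have hz1 : ‖z‖ < 1 := hz.trans_le (min_le_left _ _)
  have hzA : A * ‖z‖ < 1 := by
    have := hz.trans_le (min_le_right _ _)
    rwa [lt_div_iff₀ hA0, mul_comm] at this
  have hgeo : Summable fun k : ℕ => C * (A * ‖z‖) ^ k :=
    (summable_geometric_of_lt_one (by positivity) hzA).mul_left C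
  have hs1 : Summable fun k => a (p ^ k) * z ^ k := by
    refine hgeo.of_norm_bounded fun k => ?_
    have hk := hC (p ^ k) (pow_ne_zero _ hp.ne_zero)
    have hC0 : 0 ≤ C := by
      have := (norm_nonneg _).trans (hC 1 one_ne_zero)
      simpa using this
    rw [norm_mul, norm_pow, mul_pow, ← mul_assoc]
    gcongr
    refine hk.trans ?_
    push_cast
    rw [← pow_mul, mul_comm k 2, pow_mul]
    gcongr
    linarith [norm_nonneg c]
  have hs2 : HasSum (fun k => c ^ k * z ^ k) (1 - c * z)⁻¹ := by
    simp_rw [← mul_pow]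
    refine hasSum_geometric_of_norm_lt_one ?_
    rw [norm_mul]
    refine lt_of_le_of_lt ?_ hzA
    gcongr
    rw [hA]
    linarith [sq_nonneg (p : ℝ)]
  set s : ℂ := -(Complex.log z / Real.log p) with hs
  have hre : 0 < s.re := by
    rw [hs, Complex.neg_re, Complex.div_ofReal_re, Complex.log_re, ← neg_div]
    exact div_pos (neg_pos.2 (Real.log_neg (norm_pos_iff.2 hz0') hz1)) hlog
  have hlogc : (Real.log p : ℂ) ≠ 0 := by exact_mod_cast hlog.ne'
  have hps : (p : ℂ) ^ (-s) = z := by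
    rw [Complex.cpow_def_of_ne_zero hp0, ← Complex.natCast_log, hs, neg_neg, mul_div_cancel₀ _ hlogc,
      Complex.exp_log hz0']
  have h2 := h s hre
  rw [hps, eulerFactor] at h2
  have h3 : ∀ k : ℕ, a (p ^ k) * (p : ℂ) ^ (-((k : ℂ) * s)) = a (p ^ k) * z ^ k := by
    intro k
    rw [show -((k : ℂ) * s) = -s * k by ring, Complex.cpow_mul_nat, hps]
  simp_rw [h3] at h2
  have h4 := hs1.hasSum.sub hs2
  rw [h2, sub_self] at h4
  simpa only [sub_mul] using h4

/-- At `p ^ k` the convolution reads `k * log p * c ^ k = ∑ j ≤ k, β (p ^ j) * c ^ (k - j)`. By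
induction the terms `0 < j < k` each equal `c ^ k * log p`, so exactly one copy remains for `j = k`.
Nothing is divided by `c`, which may vanish. -/
theorem eq_pow_mul_log_of_convolution {a β : ℕ → ℂ} {p : ℕ} (hp : p.Prime) {c : ℂ}
    (ha : ∀ k, a (p ^ k) = c ^ k) (hβ : β 1 = 0)
    (hconv : ∀ n, n ≠ 0 → LSeries.logMul a n = LSeries.convolution β a n) {k : ℕ} (hk : k ≠ 0) :
    β (p ^ k) = c ^ k * Real.log p := by
  have hp0 : 0 < p := hp.pos
  have key : ∀ k : ℕ, (k : ℂ) * Real.log p * c ^ k =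
      ∑ j ∈ Finset.range (k + 1), β (p ^ j) * c ^ (k - j) := by
    intro k
    have h1 := hconv (p ^ k) (pow_ne_zero _ hp.ne_zero)
    simp only [LSeries.logMul, LSeries.convolution_def, ha] at h1
    rw [Nat.sum_divisorsAntidiagonal (fun i j => β i * a j),
      Nat.sum_divisors_prime_pow hp] at h1
    rw [← Complex.natCast_log, Nat.cast_pow, Real.log_pow, Complex.ofReal_mul,
      Complex.ofReal_natCast] at h1
    rw [h1]
    refine Finset.sum_congr rfl fun j hj => ?_
    rw [Nat.pow_div (Nat.lt_succ_iff.1 (Finset.mem_range.1 hj)) hp0, ha]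
  induction k using Nat.strong_induction_on with
  | _ k ih =>
    obtain ⟨k, rfl⟩ := Nat.exists_eq_succ_of_ne_zero hk
    have h1 := key (k + 1)
    rw [Finset.sum_range_succ, Finset.sum_range_succ'] at h1
    have h2 : ∑ j ∈ Finset.range k, β (p ^ (j + 1)) * c ^ (k + 1 - (j + 1)) =
        ∑ j ∈ Finset.range k, c ^ (k + 1) * Real.log p := by
      refine Finset.sum_congr rfl fun j hj => ?_
      have hj' := Finset.mem_range.1 hj
      rw [ih (j + 1) (by omega) (by omega), mul_right_comm, ← pow_add,
        show j + 1 + (k + 1 - (j + 1)) = k + 1 by omega]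
    rw [h2, Finset.sum_const, Finset.card_range, nsmul_eq_mul, pow_zero, hβ, zero_mul, add_zero,
      Nat.sub_self, pow_zero, mul_one] at h1
    simp only [Nat.cast_add, Nat.cast_one] at h1
    simp only [Nat.succ_eq_add_one]
    linear_combination -h1

/-- The logarithmic derivative of `L_φ` has the Dirichlet coefficients `-Λ(n) φ(n)`. -/
theorem logDeriv_eq_of_mem_interpolationClass {φ : ℝ → ℂ} (hφ : φ ∈ InterpolationClass 1)
    {L : ℂ → ℂ} (hL : L ∈ SelbergClass) (hφL : IsLFunctionOf φ L) :
    LSeries.abscissaOfAbsConv (fun n : ℕ => (ArithmeticFunction.vonMangoldt n : ℂ) * φ n) ≤ 1 ∧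
    ∀ s : ℂ, 1 < s.re → L s ≠ 0 ∧ DifferentiableAt ℂ L s ∧ logDeriv L s =
      -LSeries (fun n : ℕ => (ArithmeticFunction.vonMangoldt n : ℂ) * φ n) s := by
  obtain ⟨-, ⟨C, -, hC⟩, -, c, hc, -⟩ := hφ
  obtain ⟨a, ha, -, -, -, b, hb0, -, hb⟩ := hL
  obtain ⟨σ, hσ⟩ := hφL
  have habs : ∀ f : ℕ → ℂ, (∀ s : ℂ, 1 < s.re → LSeriesSummable f s) →
      LSeries.abscissaOfAbsConv f ≤ 1 := fun f hf =>
    LSeries.abscissaOfAbsConv_le_of_forall_lt_LSeriesSummable' fun y hy =>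
      hf y (by simpa using (EReal.coe_lt_coe_iff.1 (by simpa using hy) : (1 : ℝ) < y))
  have haa := habs a fun s hs => (ha s hs).1
  have hba := habs b fun s hs => (hb s hs).1
  have hlt : ∀ {f : ℕ → ℂ}, LSeries.abscissaOfAbsConv f ≤ 1 → ∀ s : ℂ, 1 < s.re →
      LSeries.abscissaOfAbsConv f < s.re := fun hf s hs => hf.trans_lt (by exact_mod_cast hs)
  have htop : ∀ {f : ℕ → ℂ}, LSeries.abscissaOfAbsConv f ≤ 1 →
      LSeries.abscissaOfAbsConv f < ⊤ := fun hf => hf.trans_lt (EReal.coe_lt_top 1)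
  have hφa : LSeries.abscissaOfAbsConv (fun n : ℕ => φ n) < ⊤ := by
    refine (LSeries.abscissaOfAbsConv_le_of_le_const_mul_rpow (x := 2) ⟨C, fun n hn => ?_⟩).trans_lt
      (by exact_mod_cast EReal.coe_lt_top (2 + 1))
    exact_mod_cast hC n (by positivity)
  -- The coefficients provided by the Selberg class are identified with the values of `φ` by
  -- uniqueness of Dirichlet series.
  have haφ : ∀ n : ℕ, n ≠ 0 → a n = φ n := by
    intro n hn
    refine LSeries.eq_of_LSeries_eventually_eq (htop haa) hφa ?_ hn
    filter_upwards [eventually_gt_atTop (max σ 1)] with x hx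
    rw [← (ha x (by simpa using (le_max_right _ _).trans_lt hx)).2,
      hσ x (by simpa using (le_max_left _ _).trans_lt hx)]
  set β : ℕ → ℂ := LSeries.logMul b with hβ
  have hβa : LSeries.abscissaOfAbsConv β ≤ 1 := by rwa [hβ, LSeries.abscissaOfAbsConv_logMul]
  have hopen : ∀ s : ℂ, 1 < s.re → ∀ᶠ z in 𝓝 s, 1 < z.re := fun s hs =>
    (isOpen_lt continuous_const Complex.continuous_re).mem_nhds hs
  have hLa : ∀ s : ℂ, 1 < s.re → HasDerivAt L (-LSeries (LSeries.logMul a) s) s := fun s hs => by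
    refine (LSeries_hasDerivAt (hlt haa s hs)).congr_of_eventuallyEq ?_
    filter_upwards [hopen s hs] with z hz using (ha z hz).2
  have hLb : ∀ s : ℂ, 1 < s.re → HasDerivAt L (L s * -LSeries β s) s := fun s hs => by
    rw [← (hb s hs).2]
    refine (LSeries_hasDerivAt (hlt hba s hs)).cexp.congr_of_eventuallyEq ?_
    filter_upwards [hopen s hs] with z hz using (hb z hz).2.symm
  have hne : ∀ s : ℂ, 1 < s.re → L s ≠ 0 := fun s hs => by
    rw [← (hb s hs).2]; exact Complex.exp_ne_zero _
  -- This is `-L' = L * (-L'/L)` compared coefficientwise, the derivative being computed from the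
  -- series of `L` and from that of `log L`.
  have hconv : ∀ n, n ≠ 0 → LSeries.logMul a n = LSeries.convolution β a n := by
    intro n hn
    refine LSeries.eq_of_LSeries_eventually_eq
      (htop (by rwa [LSeries.abscissaOfAbsConv_logMul]))
      ((LSeries.abscissaOfAbsConv_convolution_le β a).trans_lt
        (max_lt (htop hβa) (htop haa))) ?_ hn
    filter_upwards [eventually_gt_atTop 1] with x hx
    have hx' : 1 < (x : ℂ).re := by simpa using hx
    rw [LSeries_convolution (hlt hβa x hx') (hlt haa x hx'), ← (ha x hx').2]
    have := (hLa x hx').unique (hLb x hx')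
    linear_combination -this
  have hpow : ∀ p : ℕ, p.Prime → ∀ k, a (p ^ k) = c 1 p ^ k := by
    intro p hp k
    rw [haφ _ (pow_ne_zero _ hp.ne_zero)]
    refine apply_prime_pow_of_eulerFactor (a := fun n : ℕ => φ n) (C := C)
      (fun n hn => by exact_mod_cast hC n (by positivity)) hp (c := c 1 p) (fun s hs => ?_) k
    have := hc p hp s hs
    simpa using this
  have hβ1 : β 1 = 0 := by simp [hβ, LSeries.logMul]
  have hβΛ : ∀ n : ℕ, n ≠ 0 → β n = (ArithmeticFunction.vonMangoldt n : ℂ) * φ n := by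
    intro n hn
    by_cases hpp : IsPrimePow n
    · obtain ⟨p, k, hp, hk, rfl⟩ := (isPrimePow_nat_iff n).1 hpp
      rw [eq_pow_mul_log_of_convolution hp (hpow p hp) hβ1 hconv hk.ne', ← haφ _ hn, hpow p hp,
        ArithmeticFunction.vonMangoldt_apply_pow hk.ne',
        ArithmeticFunction.vonMangoldt_apply_prime hp, mul_comm]
    · rw [ArithmeticFunction.vonMangoldt_eq_zero_iff.2 hpp, hβ, LSeries.logMul, hb0 n hpp]
      simp
  have hLS : LSeries β = LSeries fun n : ℕ => (ArithmeticFunction.vonMangoldt n : ℂ) * φ n :=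
    funext (LSeries_congr fun {n} hn => hβΛ n hn)
  refine ⟨?_, fun s hs => ⟨hne s hs, (hLa s hs).differentiableAt, ?_⟩⟩
  · rw [← LSeries.abscissaOfAbsConv_congr fun {n} hn => hβΛ n hn]
    exact hβa
  · rw [logDeriv_apply, (hLb s hs).deriv, ← hLS, mul_div_cancel_left₀ _ (hne s hs)]

/-! ### The polar order -/

theorem IsEntireOfFiniteOrder.dslope {F : ℂ → ℂ} (hF : IsEntireOfFiniteOrder F) {w : ℂ}
    (hw : F w = 0) : IsEntireOfFiniteOrder (dslope F w) := by
  obtain ⟨hd, k, hk⟩ := hF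
  refine ⟨?_, k, IsBigO.trans (IsBigO.of_bound 1 ?_) hk⟩
  · rw [← differentiableOn_univ, Complex.differentiableOn_dslope univ_mem]
    exact hd.differentiableOn
  · have h1 : ∀ᶠ s : ℂ in Bornology.cobounded ℂ, 1 + ‖w‖ ≤ ‖s‖ :=
      tendsto_norm_cobounded_atTop.eventually_ge_atTop _
    filter_upwards [h1] with s hs
    have h2 : 1 ≤ ‖s - w‖ := by linarith [norm_sub_norm_le s w]
    have h3 : s ≠ w := by rintro rfl; simp at h2; linarith
    rw [dslope_of_ne _ h3, slope_def_field, hw, sub_zero, norm_div, one_mul]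
    exact div_le_self (norm_nonneg _) h2

/-- If the exponent were positive with `F 1 = 0`, one factor `s - 1` could be divided out, against
minimality. -/
theorem exists_entire_of_polarOrder {L : ℂ → ℂ} (h : ∃ m, IsEntireAfterPole L m) :
    ∃ F : ℂ → ℂ, IsEntireOfFiniteOrder F ∧ (∀ s, s ≠ 1 → F s = (s - 1) ^ polarOrder L * L s) ∧
      (polarOrder L = 0 ∨ F 1 ≠ 0) := by
  have hmem : IsEntireAfterPole L (polarOrder L) := Nat.sInf_mem h
  obtain ⟨F, hF, hFL⟩ := hmem
  refine ⟨F, hF, hFL, ?_⟩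
  by_contra! hcon
  obtain ⟨hm, h1⟩ := hcon
  obtain ⟨m, hm⟩ := Nat.exists_eq_succ_of_ne_zero hm
  have hmem : IsEntireAfterPole L m := by
    refine ⟨_, hF.dslope h1, fun s hs => ?_⟩
    rw [dslope_of_ne _ hs, slope_def_field, h1, sub_zero, hFL s hs, hm, pow_succ]
    field_simp [sub_ne_zero.2 hs]
  have h2 : polarOrder L ≤ m := Nat.sInf_le hmem
  omega

theorem logDeriv_of_eq_pow_mul {L F : ℂ → ℂ} {m : ℕ}
    (hFL : ∀ s, s ≠ 1 → F s = (s - 1) ^ m * L s) {s : ℂ} (hs : s ≠ 1) (hL : L s ≠ 0)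
    (hd : DifferentiableAt ℂ L s) : logDeriv F s = m / (s - 1) + logDeriv L s := by
  have hev : F =ᶠ[𝓝 s] fun z => (z - 1) ^ m * L z := by
    filter_upwards [eventually_ne_nhds hs] with z hz using hFL z hz
  have h1 : s - 1 ≠ 0 := sub_ne_zero.2 hs
  rw [logDeriv_apply, hev.deriv_eq, hev.eq_of_nhds, ← logDeriv_apply (fun z => (z - 1) ^ m * L z),
    logDeriv_mul (f := fun z => (z - 1) ^ m) s (pow_ne_zero _ h1) hL (by fun_prop) hd,
    logDeriv_fun_pow (f := fun z : ℂ => z - 1) (by fun_prop)]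
  congr 1
  rw [logDeriv_apply, deriv_sub_const, deriv_id'']
  ring

/-! ### Test functions in logarithmic coordinates -/

theorem exists_bounds_of_mem_testFunctions {h : ℝ → ℂ} (hh : h ∈ TestFunctions) :
    ∃ a b : ℝ, 0 < a ∧ 0 < b ∧ ∀ u, h u ≠ 0 → a ≤ u ∧ u ≤ b := by
  obtain ⟨-, hc, hs⟩ := hh
  rcases (tsupport h).eq_empty_or_nonempty with he | hne
  · refine ⟨1, 1, one_pos, one_pos, fun u hu => ?_⟩
    exact absurd (he ▸ subset_tsupport h hu) (notMem_empty u)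
  · have hc' : IsCompact (tsupport h) := hc
    obtain ⟨a, ha, hal⟩ := hc'.exists_isLeast hne
    obtain ⟨b, hb, hbg⟩ := hc'.exists_isGreatest hne
    exact ⟨a, b, hs ha, hs hb, fun u hu =>
      ⟨hal (subset_tsupport h hu), hbg (subset_tsupport h hu)⟩⟩

theorem hasCompactSupport_comp_mul_exp {h : ℝ → ℂ} {a b : ℝ} (ha : 0 < a) (hb : 0 < b)
    (hab : ∀ u, h u ≠ 0 → a ≤ u ∧ u ≤ b) {x : ℝ} (hx : 0 < x) :
    HasCompactSupport fun y => h (x * Real.exp y) := by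
  refine HasCompactSupport.of_support_subset_isCompact
    (isCompact_Icc (a := Real.log (a / x)) (b := Real.log (b / x))) fun y hy => ?_
  obtain ⟨h1, h2⟩ := hab _ hy
  rw [mem_Icc, Real.log_le_iff_le_exp (by positivity), Real.le_log_iff_exp_le (by positivity),
    div_le_iff₀ hx, le_div_iff₀ hx]
  constructor <;> linarith

theorem one_le_of_apply_mul_exp_ne_zero {h : ℝ → ℂ} {a b : ℝ}
    (hab : ∀ u, h u ≠ 0 → a ≤ u ∧ u ≤ b) {x : ℝ} (hxa : x ≤ a / Real.exp 1)
    (hx : 0 < x) {y : ℝ} (hy : h (x * Real.exp y) ≠ 0) : 1 ≤ y := by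
  rw [← Real.exp_le_exp]
  rw [le_div_iff₀ (Real.exp_pos 1)] at hxa
  exact le_of_mul_le_mul_left (hxa.trans (hab _ hy).1) hx

theorem tsupport_subset_Ioi_of_one_le {f : ℝ → ℂ} (hf : ∀ y, f y ≠ 0 → 1 ≤ y) :
    tsupport f ⊆ Ioi 0 :=
  (closure_minimal (t := Ici 1) hf isClosed_Ici).trans fun _ hy => mem_Ioi.2 (one_pos.trans_le (mem_Ici.1 hy))

theorem bilateralLaplace_comp_sub (f : ℝ → ℂ) (t : ℝ) (s : ℂ) :
    bilateralLaplace (fun y => f (y - t)) s = Complex.exp (s * t) * bilateralLaplace f s := by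
  unfold bilateralLaplace
  rw [← integral_sub_right_eq_self (fun y : ℝ => f y * Complex.exp (s * y)) t,
    ← integral_const_mul]
  refine integral_congr_ae (Eventually.of_forall fun y => ?_)
  simp only
  rw [mul_left_comm, ← Complex.exp_add]
  congr 2
  push_cast
  ring

theorem mul_exp_sub_log_div {x y : ℝ} (hx : 0 < x) (hy : 0 < y) (t : ℝ) :
    y * Real.exp (t - Real.log (y / x)) = x * Real.exp t := by
  rw [Real.exp_sub, Real.exp_log (by positivity)]
  field_simp

/-- Passing from `x₀` to `x` translates by `t = log (x₀ / x) ≥ 0` and so multiplies the transform by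
`exp (ρ t)`, of modulus at most 1. -/
theorem norm_bilateralLaplace_comp_mul_exp_le (h : ℝ → ℂ) {x x₀ : ℝ} (hx : 0 < x) (hx₀ : x ≤ x₀)
    {ρ : ℂ} (hρ : ρ.re ≤ 0) : ‖bilateralLaplace (fun y => h (x * Real.exp y)) ρ‖ ≤
      ‖bilateralLaplace (fun y => h (x₀ * Real.exp y)) ρ‖ := by
  have h1 := bilateralLaplace_comp_sub (fun y => h (x₀ * Real.exp y)) (Real.log (x₀ / x)) ρ
  simp only [mul_exp_sub_log_div hx (hx.trans_le hx₀)] at h1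
  have ht : 0 ≤ Real.log (x₀ / x) := Real.log_nonneg ((one_le_div hx).2 hx₀)
  rw [h1, norm_mul, Complex.norm_exp, Complex.re_mul_ofReal]
  exact mul_le_of_le_one_left (norm_nonneg _)
    (Real.exp_le_one_iff.2 (mul_nonpos_of_nonpos_of_nonneg hρ ht))

/-- If `φ(u) = O(u²)` and `h(x₀ eʸ)` vanishes for `y < 1`, then the transform of
`h(x eʸ) φ(eʸ)` decays exponentially in the half-plane `re ρ ≤ -2`, uniformly in `x ≤ x₀`. -/
theorem norm_bilateralLaplace_mul_le {h φ : ℝ → ℂ} {C : ℝ}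
    (hC : ∀ u : ℝ, 0 < u → ‖φ u‖ ≤ C * u ^ 2) {x x₀ : ℝ} (hx : 0 < x) (hx₀ : x ≤ x₀)
    (hh : Continuous h) (hφ : Continuous fun y => φ (Real.exp y))
    (hc : ∀ x, 0 < x → HasCompactSupport fun y => h (x * Real.exp y))
    (h1 : ∀ y, h (x₀ * Real.exp y) ≠ 0 → 1 ≤ y) {ρ : ℂ} (hρ : ρ.re ≤ -2) :
    ‖bilateralLaplace (fun y => h (x * Real.exp y) * φ (Real.exp y)) ρ‖ ≤
      C * (∫ y, ‖h (x₀ * Real.exp y)‖) * Real.exp (2 + ρ.re) := by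
  have hx₀' := hx.trans_le hx₀
  have hC0 : 0 ≤ C := by
    have := (norm_nonneg _).trans (hC 1 one_pos)
    simpa using this
  have hcont : ∀ x : ℝ, Continuous fun y => h (x * Real.exp y) := fun x => by fun_prop
  have hint : ∀ (x : ℝ) (_ : 0 < x) (g : ℝ → ℝ), Continuous g →
      Integrable fun y => ‖h (x * Real.exp y)‖ * g y := fun x hx g hg =>
    ((hcont x).norm.mul hg).integrable_of_hasCompactSupport ((hc x hx).norm.mul_right)
  have ht : 0 ≤ Real.log (x₀ / x) := Real.log_nonneg ((one_le_div hx).2 hx₀)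
  set t := Real.log (x₀ / x) with htdef
  calc ‖bilateralLaplace (fun y => h (x * Real.exp y) * φ (Real.exp y)) ρ‖
      ≤ ∫ y, ‖h (x * Real.exp y) * φ (Real.exp y)‖ * Real.exp (ρ.re * y) :=
        norm_bilateralLaplace_le _ _
    _ ≤ ∫ y, C * (‖h (x * Real.exp y)‖ * Real.exp ((2 + ρ.re) * y)) := by
        refine integral_mono ?_ ((hint x hx _ (by fun_prop)).const_mul C) fun y => ?_
        · simp_rw [norm_mul, mul_assoc]
          exact hint x hx _ (hφ.norm.mul (by fun_prop))
        · have h2 := hC _ (Real.exp_pos y)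
          have h3 : Real.exp ((2 + ρ.re) * y) = Real.exp y ^ 2 * Real.exp (ρ.re * y) := by
            rw [← Real.exp_nat_mul, ← Real.exp_add]
            congr 1
            push_cast
            ring
          simp only [norm_mul, h3]
          calc ‖h (x * Real.exp y)‖ * ‖φ (Real.exp y)‖ * Real.exp (ρ.re * y)
              ≤ ‖h (x * Real.exp y)‖ * (C * Real.exp y ^ 2) * Real.exp (ρ.re * y) := by gcongr
            _ = _ := by ring
    _ = C * ∫ y, ‖h (x₀ * Real.exp y)‖ * Real.exp ((2 + ρ.re) * (y + t)) := by
        rw [integral_const_mul,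
          ← integral_sub_right_eq_self
            (fun y : ℝ => ‖h (x₀ * Real.exp y)‖ * Real.exp ((2 + ρ.re) * (y + t))) t]
        simp only [htdef, mul_exp_sub_log_div hx hx₀', sub_add_cancel]
    -- On the support `y + t ≥ 1`, while `2 + ρ.re ≤ 0`.
    _ ≤ C * ∫ y, ‖h (x₀ * Real.exp y)‖ * Real.exp (2 + ρ.re) := by
        refine mul_le_mul_of_nonneg_left ?_ hC0
        refine integral_mono (hint x₀ hx₀' _ (by fun_prop)) (hint x₀ hx₀' _ (by fun_prop))
          fun y => ?_
        by_cases hy : h (x₀ * Real.exp y) = 0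
        · simp [hy]
        · have h2 := h1 y hy
          refine mul_le_mul_of_nonneg_left (Real.exp_le_exp.2 ?_) (norm_nonneg _)
          nlinarith
    _ = _ := by rw [integral_mul_const, mul_assoc]

/-! ### Sums over zeros -/

theorem zeroTerm_eq (f : ℂ → ℂ) (g : ℝ → ℂ) (ρ : ℂ) : zeroTerm f g ρ =
    (zeroMultiplicity f ρ : ℂ) * bilateralLaplace (fun y => g (Real.exp y)) ρ := by
  rw [zeroTerm, integral_Ioi_mul_cpow_div]

theorem integral_Ioi_eq_bilateralLaplace_one (g : ℝ → ℂ) :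
    ∫ u in Ioi (0 : ℝ), g u = bilateralLaplace (fun y => g (Real.exp y)) 1 := by
  rw [← integral_Ioi_mul_cpow_div]
  refine setIntegral_congr_fun measurableSet_Ioi fun u hu => ?_
  have : (u : ℂ) ≠ 0 := by exact_mod_cast (mem_Ioi.1 hu).ne'
  simp only [Complex.cpow_one]
  rw [mul_div_cancel_right₀ _ this]

/-- The zeros that count lie in `0 ≤ re ρ ≤ 1`, where the transform decays faster than their
polynomial density grows. -/
theorem summable_natCast_mul_bilateralLaplace {F : ℂ → ℂ} (hF : IsEntireOfFiniteOrder F)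
    (hne : ∀ s, 1 < s.re → F s ≠ 0) {μ : ℂ → ℕ} (hμ : ∀ ρ, μ ρ ≤ analyticOrderNatAt F ρ)
    (hμ0 : ∀ ρ, ρ.re < 0 → μ ρ = 0) {f : ℝ → ℂ} (hf : ContDiff ℝ ∞ f)
    (hc : HasCompactSupport f) : Summable fun ρ => (μ ρ : ℂ) * bilateralLaplace f ρ := by
  obtain ⟨C, K, hC, hg⟩ := hF.exists_hasExpGrowth
  have hw : F 2 ≠ 0 := hne 2 (by norm_num)
  obtain ⟨M, hM, hb⟩ := exists_bilateralLaplace_decay hf hc 1 (K + 1)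
  refine ((summable_analyticOrderNatAt_div hF.1 hC hg hw).mul_left M).of_norm_bounded fun ρ => ?_
  rw [norm_mul, Complex.norm_natCast]
  rcases lt_or_ge ρ.re 0 with h | h
  · rw [hμ0 ρ h]; simp; positivity
  rcases lt_or_ge 1 ρ.re with h' | h'
  · have h2 : μ ρ = 0 := by
      have := hμ ρ
      rw [analyticOrderNatAt_eq_zero_of_ne (hne ρ h')] at this
      omega
    rw [h2]; simp; positivity
  · calc (μ ρ : ℝ) * ‖bilateralLaplace f ρ‖
        ≤ analyticOrderNatAt F ρ * (M / (1 + ‖ρ‖) ^ (K + 1)) := by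
          gcongr
          · exact hμ ρ
          · exact hb ρ (abs_le.2 ⟨by linarith, h'⟩)
      _ = _ := by ring

theorem summable_analyticOrderNatAt_mul_exp_neg {F : ℂ → ℂ} (hF : IsEntireOfFiniteOrder F)
    {w : ℂ} (hw : F w ≠ 0) :
    Summable fun ρ => (analyticOrderNatAt F ρ : ℝ) * Real.exp (-‖ρ‖) := by
  obtain ⟨C, K, hC, hg⟩ := hF.exists_hasExpGrowth
  refine ((summable_analyticOrderNatAt_div hF.1 hC hg hw).mul_left
    ((K + 1).factorial * Real.exp 1)).of_nonneg_of_le (fun ρ => by positivity) fun ρ => ?_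
  have h1 := Real.pow_div_factorial_le_exp (1 + ‖ρ‖) (by positivity) (K + 1)
  rw [div_le_iff₀ (by positivity), Real.exp_add] at h1
  rw [Real.exp_neg, ← div_eq_mul_inv, ← mul_div_assoc,
    div_le_div_iff₀ (Real.exp_pos _) (by positivity)]
  calc (analyticOrderNatAt F ρ : ℝ) * (1 + ‖ρ‖) ^ (K + 1)
      ≤ analyticOrderNatAt F ρ * (Real.exp 1 * Real.exp ‖ρ‖ * (K + 1).factorial) := by gcongr
    _ = _ := by ring

/-- Applied with `n` the multiplicities for `F` and `μ` those for the completed function: the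
discrepancy lives on the cancelled zeros, and `β` is a majorant free of `x`. -/
theorem norm_sub_tsum_natCast_mul_le {n μ : ℂ → ℕ} (hμ : ∀ ρ, μ ρ ≤ n ρ) {B : ℂ → ℂ} {A : ℂ}
    (hA : HasSum (fun ρ => (n ρ : ℂ) * B ρ) A) (hZ : Summable fun ρ => (μ ρ : ℂ) * B ρ)
    {β : ℂ → ℝ} (hβ : Summable fun ρ => (n ρ : ℝ) * β ρ) (hβ0 : ∀ ρ, 0 ≤ β ρ)
    (hB : ∀ ρ, μ ρ ≠ n ρ → ‖B ρ‖ ≤ β ρ) :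
    ‖A - ∑' ρ, (μ ρ : ℂ) * B ρ‖ ≤ ∑' ρ, (n ρ : ℝ) * β ρ := by
  have h1 := hA.sub hZ.hasSum
  rw [← h1.tsum_eq]
  refine tsum_of_norm_bounded hβ.hasSum fun ρ => ?_
  rw [← sub_mul]
  by_cases h : μ ρ = n ρ
  · rw [h, sub_self, zero_mul, norm_zero]
    exact mul_nonneg (Nat.cast_nonneg _) (hβ0 ρ)
  · rw [norm_mul, ← Nat.cast_sub (hμ ρ), Complex.norm_natCast]
    gcongr
    · exact Nat.sub_le _ _
    · exact hB ρ h

theorem tsum_vonMangoldt_mul_eq (φ h : ℝ → ℂ) (x : ℝ) :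
    ∑' n : ℕ, ((ArithmeticFunction.vonMangoldt n : ℂ) * φ n) * h (x * Real.exp (Real.log n)) =
      ∑' n : ℕ, (ArithmeticFunction.vonMangoldt n : ℂ) *
        (h (x * Real.exp (Real.log n)) * φ (Real.exp (Real.log n))) := by
  refine tsum_congr fun n => ?_
  -- At `n = 0` the arguments of `φ` disagree, since `exp (log 0) = 1`, but `Λ(0) = 0`.
  rcases eq_or_ne n 0 with rfl | hn
  · simp
  · rw [Real.exp_log (by positivity)]
    ring

/-! ### Comparison of the two explicit formulas -/

theorem theorem1 (φ : ℝ → ℂ) (hφ : φ ∈ InterpolationClass 1)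
    (L : ℂ → ℂ) (hL : L ∈ SelbergClass) (hφL : IsLFunctionOf φ L)
    (G : GammaFactor) (hG : G.FunctionalEquation L)
    (h : ℝ → ℂ) (hh : h ∈ TestFunctions) :
    (∀ x : ℝ, 0 < x →
      Summable (zeroTerm (G.complete L) (fun u => h (x * u))) ∧
      Summable (zeroTerm completedRiemannZeta (fun u => h (x * u) * φ u))) ∧
    (fun x : ℝ =>
      ((polarOrder L : ℂ) * (∫ u in Ioi (0 : ℝ), h (x * u))
        - ∑' ρ : ℂ, zeroTerm (G.complete L) (fun u => h (x * u)) ρ)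
      - ((∫ u in Ioi (0 : ℝ), h (x * u) * φ u)
        - ∑' ρ : ℂ, zeroTerm completedRiemannZeta (fun u => h (x * u) * φ u) ρ))
      =O[𝓝[>] (0 : ℝ)] (fun _ : ℝ => (1 : ℝ)) := by
  obtain ⟨habs, hlogL⟩ := logDeriv_eq_of_mem_interpolationClass hφ hL hφL
  obtain ⟨⟨hφd, -⟩, ⟨C, -, hC⟩, -, -⟩ := hφ
  obtain ⟨-, -, hcont, -⟩ := hL
  obtain ⟨F, hF, hFL, hF1⟩ := exists_entire_of_polarOrder hcont
  obtain ⟨a, b, ha, hb, hab⟩ := exists_bounds_of_mem_testFunctions hh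
  obtain ⟨hhd, -, -⟩ := hh
  have hne1 : ∀ s : ℂ, 1 < s.re → s ≠ 1 := by rintro s hs rfl; simp at hs
  have hFne : ∀ s : ℂ, 1 < s.re → F s ≠ 0 := fun s hs => by
    rw [hFL s (hne1 s hs)]
    exact mul_ne_zero (pow_ne_zero _ (sub_ne_zero.2 (hne1 s hs))) (hlogL s hs).1
  have hFlog : ∀ s : ℂ, 1 < s.re → logDeriv F s = polarOrder L / (s - 1) -
      LSeries (fun n : ℕ => (ArithmeticFunction.vonMangoldt n : ℂ) * φ n) s := fun s hs => by
    obtain ⟨h1, h2, h3⟩ := hlogL s hs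
    rw [logDeriv_of_eq_pow_mul hFL (hne1 s hs) h1 h2, h3, ← sub_eq_add_neg]
  have hF2 : F 2 ≠ 0 := hFne 2 (by norm_num)
  have hζne : ∀ s : ℂ, 1 < s.re → zetaEntire s ≠ 0 := fun s hs => zetaEntire_ne_zero hs.le
  have hfd : ∀ x : ℝ, ContDiff ℝ ∞ fun y => h (x * Real.exp y) := fun x =>
    hhd.comp (contDiff_const.mul Real.contDiff_exp)
  have hφe : ContDiff ℝ ∞ fun y => φ (Real.exp y) :=
    hφd.comp_contDiff Real.contDiff_exp fun y => Real.exp_pos y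
  have hgd : ∀ x : ℝ, ContDiff ℝ ∞ fun y => h (x * Real.exp y) * φ (Real.exp y) := fun x =>
    (hfd x).mul hφe
  have hfc : ∀ x : ℝ, 0 < x → HasCompactSupport fun y => h (x * Real.exp y) := fun x hx =>
    hasCompactSupport_comp_mul_exp ha hb hab hx
  have hgc : ∀ x : ℝ, 0 < x → HasCompactSupport fun y => h (x * Real.exp y) * φ (Real.exp y) :=
    fun x hx => (hfc x hx).mul_right
  have hle := zeroMultiplicity_complete_le G hF.1 hF2 hFL
  have hsumL : ∀ x : ℝ, 0 < x → Summable fun ρ => (zeroMultiplicity (G.complete L) ρ : ℂ) *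
      bilateralLaplace (fun y => h (x * Real.exp y)) ρ := fun x hx =>
    summable_natCast_mul_bilateralLaplace hF hFne hle
      (fun ρ hρ => zeroMultiplicity_complete_eq_zero G hG hF.1 hFL hFne hρ) (hfd x) (hfc x hx)
  have hsumζ : ∀ x : ℝ, 0 < x → Summable fun ρ => (zeroMultiplicity completedRiemannZeta ρ : ℂ) *
      bilateralLaplace (fun y => h (x * Real.exp y) * φ (Real.exp y)) ρ := fun x hx =>
    summable_natCast_mul_bilateralLaplace isEntireOfFiniteOrder_zetaEntire hζne
      zeroMultiplicity_completedRiemannZeta_le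
      (fun ρ hρ => zeroMultiplicity_completedRiemannZeta_of_re_neg hρ) (hgd x) (hgc x hx)
  refine ⟨fun x hx => ⟨(hsumL x hx).congr fun ρ => (zeroTerm_eq _ (fun u => h (x * u)) ρ).symm,
    (hsumζ x hx).congr fun ρ => (zeroTerm_eq _ (fun u => h (x * u) * φ u) ρ).symm⟩, ?_⟩
  simp only [zeroTerm_eq, integral_Ioi_eq_bilateralLaplace_one]
  -- For `x ≤ x₀` the function `h(x exp y)` lives on `y ≥ 1`, so the explicit formulas apply.
  set x₀ := a / Real.exp 1 with hx₀
  have hx₀pos : 0 < x₀ := by positivity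
  have hone : ∀ x : ℝ, 0 < x → x ≤ x₀ → ∀ y, h (x * Real.exp y) ≠ 0 → 1 ≤ y := fun x hx hxx y hy =>
    one_le_of_apply_mul_exp_ne_zero hab hxx hx hy
  have hLsum := fun x (hx : 0 < x) (hxx : x ≤ x₀) =>
    hasSum_zeros_explicit_formula hF habs hFne hFlog (hfd x) (hfc x hx)
      (tsupport_subset_Ioi_of_one_le (hone x hx hxx))
  have hζsum := fun x (hx : 0 < x) (hxx : x ≤ x₀) =>
    hasSum_zeros_explicit_formula isEntireOfFiniteOrder_zetaEntire abscissaOfAbsConv_vonMangoldt_le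
      hζne (fun s hs => logDeriv_zetaEntire hs) (hgd x) (hgc x hx)
      (tsupport_subset_Ioi_of_one_le fun y hy => hone x hx hxx y (left_ne_zero_of_mul hy))
  -- The explicit formula at `x₀` already sums absolutely over all zeros of `F`, so the trivial
  -- zeros need not be located.
  have hβL : Summable fun ρ => (analyticOrderNatAt F ρ : ℝ) *
      ‖bilateralLaplace (fun y => h (x₀ * Real.exp y)) ρ‖ := by
    simpa using (hLsum x₀ hx₀pos le_rfl).summable.norm
  set D := C * (∫ y, ‖h (x₀ * Real.exp y)‖) * Real.exp 2 with hD
  have hC0 : 0 ≤ C := by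
    have := (norm_nonneg _).trans (hC 1 one_pos)
    simpa using this
  have hD0 : 0 ≤ D :=
    mul_nonneg (mul_nonneg hC0 (integral_nonneg fun y => norm_nonneg _)) (Real.exp_nonneg _)
  have hβζ : Summable fun ρ => (analyticOrderNatAt zetaEntire ρ : ℝ) *
      (D * Real.exp (-‖ρ‖)) := by
    refine ((summable_analyticOrderNatAt_mul_exp_neg isEntireOfFiniteOrder_zetaEntire
      (zetaEntire_ne_zero (s := 1) (by simp))).mul_left D).congr fun ρ => by ring
  refine IsBigO.of_bound ((∑' ρ, (analyticOrderNatAt F ρ : ℝ) *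
      ‖bilateralLaplace (fun y => h (x₀ * Real.exp y)) ρ‖) +
      ∑' ρ, (analyticOrderNatAt zetaEntire ρ : ℝ) * (D * Real.exp (-‖ρ‖))) ?_
  filter_upwards [Ioc_mem_nhdsGT hx₀pos] with x hx
  obtain ⟨hx0, hxx⟩ := hx
  have h1 := norm_sub_tsum_natCast_mul_le hle (hLsum x hx0 hxx) (hsumL x hx0) hβL
    (fun ρ => norm_nonneg _) fun ρ hρ => norm_bilateralLaplace_comp_mul_exp_le h hx0 hxx <|
      not_lt.1 fun hpos => hρ (zeroMultiplicity_complete_eq G hF.1 hF2 hFL hF1 hpos)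
  have h2 := norm_sub_tsum_natCast_mul_le zeroMultiplicity_completedRiemannZeta_le
    (hζsum x hx0 hxx) (hsumζ x hx0) hβζ (fun ρ => mul_nonneg hD0 (Real.exp_nonneg _))
    fun ρ hρ => by
      have hre : ρ.re ≤ 0 :=
        not_lt.1 fun hpos => hρ (zeroMultiplicity_completedRiemannZeta_of_re_pos hpos)
      have hz : zetaEntire ρ = 0 := by
        by_contra hz
        have h3 := zeroMultiplicity_completedRiemannZeta_le ρ
        rw [analyticOrderNatAt_eq_zero_of_ne hz] at h3 hρ
        omega
      obtain ⟨h3, h4⟩ := zetaEntire_eq_zero_of_re_nonpos hre hz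
      refine (norm_bilateralLaplace_mul_le hC hx0 hxx hhd.continuous hφe.continuous hfc
        (hone x₀ hx₀pos le_rfl) h3).trans (le_of_eq ?_)
      rw [h4, neg_neg, hD, Real.exp_add]
      ring
  -- The two prime sums now coincide and cancel in the difference of the quantities bounded by `h1`
  -- and `h2`.
  simp only [tsum_vonMangoldt_mul_eq φ h x] at h1
  rw [norm_one, mul_one]
  refine le_trans (le_of_eq ?_) ((norm_sub_le _ _).trans (add_le_add h1 h2))
  congr 1
  push_cast
  ring
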